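/- Let $\mathbf H$ be a complex Hilbert space and $A:\mathfrak D(A)\subset\mathbf H\to\mathbf H$ a strictly positive selfadjoint operator with compact inverse. Let $\alpha,\beta,a,\eta$ be real numbers with $\beta>\alpha>0$, $a\neq 0$ and $\eta\neq0$. Let $\mathbb H=\mathfrak D(A^{1/2})\times\mathfrak D(A^{1/2})\times\mathbf H\times\mathbf H$, with the inner product whose norm is $$\|U\|_{\mathbb H}^2=a^2\alpha(\beta-\alpha)\|A^{1/2}v\|^2+a^2\|A^{1/2}u+\alpha A^{1/2}v\|^2+\|v+\alpha w\|^2+\|\theta\|^2,\qquad U=(u,v,w,\theta).$$ For $\phi\in[0,1]$ let $\mathbb B$ be the operator on $\mathbb H$ with domain $$\mathfrak D(\mathbb B)=\{U\in\mathbb H:\ v,w\in\mathfrak D(A^{1/2}),\ a^2u+a^2\beta v-\eta A^{\phi-1}\theta\in\mathfrak D(A),\ \eta A^{\phi-1}v+\alpha\eta A^{\phi-1}w+\theta\in\mathfrak D(A)\}$$ and $$\mathbb BU=\Big(v,\ w,\ -\tfrac1\alpha\big[A(a^2u+a^2\beta v-\eta A^{\phi-1}\theta)+w\big],\ -A(\eta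 A^{\phi-1}v+\alpha\eta A^{\phi-1}w+\theta)\Big),$$ that is, the operator of the Moore--Gibson--Thompson--Fourier system $\alpha u_{ttt}+u_{tt}+a^2Au+a^2\beta Au_t-\eta A^\phi\theta=0$, $\ \theta_t+A\theta+\alpha\eta A^\phi u_{tt}+\eta A^\phi u_t=0$, written for $U=(u,u_t,u_{tt},\theta)$. Then for $\phi=1$ the operator $\mathbb B$ generates a $C_0$-semigroup of contractions $S(t)=e^{t\mathbb B}$ on $\mathbb H$, and $S(t)$ is analytic: for some $\vartheta\in(0,\pi/2)$ it extends to a family $T(z)$ of bounded operators, $z\in\{0\}\cup\{z\neq0:|\arg z|<\vartheta\}$, which satisfies $T(z+z')=T(z)T(z')$, is strongly continuous on this sector (including $z=0$), and is holomorphic in operator norm for $z\ne0$. -/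

import Mathlib

open Filter Topology

/-! ### Strongly continuous and analytic semigroups -/

section Semigroups

variable {X : Type*} [NormedAddCommGroup X] [NormedSpace ℂ X]

/-- `S : [0,∞) → 𝓛(X)` is a strongly continuous (`C₀`) semigroup. The family is indexed by `ℝ`, and
only its values at `t ≥ 0` matter. -/
structure IsC0Semigroup (S : ℝ → X →L[ℂ] X) : Prop where
  map_zero : S 0 = ContinuousLinearMap.id ℂ X
  map_add : ∀ s t : ℝ, 0 ≤ s → 0 ≤ t → S (s + t) = (S s).comp (S t)
  tendsto_zero : ∀ x : X, Tendsto (fun t : ℝ => S t x) (𝓝[>] 0) (𝓝 x)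

/-- `B` is the infinitesimal generator of `S`: `x ∈ D(B)` and `B x = y` if and only if
`(S t x - x) / t → y` as `t → 0⁺`. -/
def IsGenerator (B : X →ₗ.[ℂ] X) (S : ℝ → X →L[ℂ] X) : Prop :=
  ∀ x y : X, (x, y) ∈ B.graph ↔
    Tendsto (fun t : ℝ => ((t : ℂ)⁻¹) • (S t x - x)) (𝓝[>] 0) (𝓝 y)

/-- The open sector `{z ≠ 0 : |arg z| < θ}`. -/
def openSector (θ : ℝ) : Set ℂ := {z | z ≠ 0 ∧ |Complex.arg z| < θ}

/-- The semigroup `S` is analytic: for some `θ ∈ (0, π/2)` it extends to a family `T` on the sector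
`{0} ∪ {|arg z| < θ}` which satisfies the semigroup law, is strongly continuous on the sector
(the vertex included), and is holomorphic in operator norm away from the vertex. -/
def IsAnalyticSemigroup (S : ℝ → X →L[ℂ] X) : Prop :=
  ∃ θ : ℝ, 0 < θ ∧ θ < Real.pi / 2 ∧ ∃ T : ℂ → X →L[ℂ] X,
    (∀ t : ℝ, 0 ≤ t → T (t : ℂ) = S t) ∧
    (∀ z ∈ insert 0 (openSector θ), ∀ w ∈ insert 0 (openSector θ),
      T (z + w) = (T z).comp (T w)) ∧
    (∀ x : X, ContinuousOn (fun z : ℂ => T z x) (insert 0 (openSector θ))) ∧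
    DifferentiableOn ℂ T (openSector θ)

end Semigroups

/-! ### The operator `A` and its powers -/

/-- A strictly positive selfadjoint (unbounded) operator `A` with compact inverse on a complex
Hilbert space `H`. The field `inv` is the inverse `A⁻¹`, which the laws determine. -/
structure StrictlyPositiveOperator (H : Type*) [NormedAddCommGroup H] [InnerProductSpace ℂ H]
    [CompleteSpace H] where
  toLinearPMap : H →ₗ.[ℂ] H
  isSelfAdjoint : IsSelfAdjoint toLinearPMap
  re_inner_pos : ∀ x : toLinearPMap.domain, x ≠ 0 → 0 < (inner ℂ (toLinearPMap x) (x : H)).re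
  inv : H →L[ℂ] H
  inv_mem : ∀ x : H, inv x ∈ toLinearPMap.domain
  apply_inv : ∀ x : H, toLinearPMap ⟨inv x, inv_mem x⟩ = x
  inv_apply : ∀ x : toLinearPMap.domain, inv (toLinearPMap x) = x
  inv_compact : IsCompactOperator inv

namespace StrictlyPositiveOperator

variable {H : Type*} [NormedAddCommGroup H] [InnerProductSpace ℂ H] [CompleteSpace H]
  (A : StrictlyPositiveOperator H)

/-- The bounded operator `A^(-s)`, for `s ≥ 0`: the `s`-th power of the bounded positive operator
`A⁻¹`, through the continuous functional calculus. -/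
noncomputable def negPow (s : ℝ) : H →L[ℂ] H := A.inv ^ s

/-- The (in general unbounded) operator `A^s`, for `s ≥ 0`: the inverse of `A^(-s)`, with domain
the range of `A^(-s)`. -/
noncomputable def posPow (s : ℝ) : H →ₗ.[ℂ] H :=
  ((A.negPow s).toLinearMap.toPMap ⊤).inverse

/-- The domain of the square root of `A`. -/
noncomputable abbrev halfDomain : Submodule ℂ H := (A.posPow (1 / 2)).domain

/-- The square root of `A`, as a linear map on its domain. -/
noncomputable def half : A.halfDomain →ₗ[ℂ] H := (A.posPow (1 / 2)).toFun

theorem inv_nonneg : 0 ≤ A.inv := by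
  have hs : IsSelfAdjoint A.toLinearPMap := A.isSelfAdjoint
  have key : ∀ x y : A.toLinearPMap.domain,
      inner ℂ (A.toLinearPMap x) (y : H) = inner ℂ (x : H) (A.toLinearPMap y) := by
    have h := LinearPMap.adjoint_isFormalAdjoint hs.dense_domain
    rw [LinearPMap.isSelfAdjoint_def.1 hs] at h
    exact fun x y => h x y
  rw [ContinuousLinearMap.nonneg_iff_isPositive, ContinuousLinearMap.isPositive_iff_complex]
  intro x
  have h1 := key ⟨A.inv x, A.inv_mem x⟩ ⟨A.inv x, A.inv_mem x⟩
  rw [A.apply_inv] at h1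
  have h2 : inner ℂ (A.inv x) x = (starRingEnd ℂ) (inner ℂ (A.inv x) x) := by
    rw [inner_conj_symm]; exact h1.symm
  refine ⟨(Complex.conj_eq_iff_re.1 h2.symm), ?_⟩
  by_cases hx : A.inv x = 0
  · simp [hx]
  · have h3 := A.re_inner_pos ⟨A.inv x, A.inv_mem x⟩ (by simpa using hx)
    rw [A.apply_inv] at h3
    change 0 < (inner ℂ x (A.inv x)).re at h3
    rw [← inner_conj_symm, Complex.conj_re] at h3
    exact h3.le

theorem negPow_half_injective : Function.Injective (A.negPow (1 / 2)) := by
  have h : A.negPow (1 / 2) * A.negPow (1 / 2) = A.inv := by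
    unfold negPow
    rw [← CFC.sqrt_eq_rpow]
    exact CFC.sqrt_mul_sqrt_self _ A.inv_nonneg
  rw [injective_iff_map_eq_zero]
  intro x hx
  have h0 : A.inv x = 0 := by rw [← h, mul_apply_eq_comp, hx, map_zero]
  have h2 := A.apply_inv x
  have h3 : (⟨A.inv x, A.inv_mem x⟩ : A.toLinearPMap.domain) = 0 := Subtype.ext h0
  rw [h3, LinearPMap.map_zero] at h2
  exact h2.symm

theorem half_injective (x : A.halfDomain) (hx : A.half x = 0) : x = 0 := by
  have hker : ((A.negPow (1 / 2)).toLinearMap.toPMap ⊤).toFun.ker = ⊥ := by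
    rw [LinearMap.ker_eq_bot']
    intro m hm
    apply Subtype.ext
    apply A.negPow_half_injective
    rw [Submodule.coe_zero, map_zero]
    exact hm
  obtain ⟨x, hx'⟩ := x
  have hr := hx'
  unfold halfDomain posPow at hr
  rw [LinearPMap.inverse_domain] at hr
  obtain ⟨y, hy⟩ := hr
  have h := LinearPMap.inverse_apply_eq hker (y := ⟨x, hx'⟩) (x := y) hy
  have h0 : (y : H) = 0 := h.symm.trans hx
  apply Subtype.ext
  have hy0 : y = 0 := Subtype.ext h0
  rw [hy0, LinearMap.map_zero] at hy
  exact hy.symm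

end StrictlyPositiveOperator

/-! ### The Moore--Gibson--Thompson--Fourier system -/

/-- The coefficients of the system, in the regime `β > α > 0`. -/
structure MGTFourierCoeffs where
  α : ℝ
  β : ℝ
  a : ℝ
  η : ℝ
  α_pos : 0 < α
  α_lt_β : α < β
  a_ne_zero : a ≠ 0

namespace MGTFourier

variable {H : Type*} [NormedAddCommGroup H] [InnerProductSpace ℂ H] [CompleteSpace H]

/-- The phase space `D(A^(1/2)) × D(A^(1/2)) × H × H`, whose elements are `U = (u, v, w, θ)`. It
carries the inner product defined below, and not the norm of a product. -/
def PhaseSpace (A : StrictlyPositiveOperator H) (_c : MGTFourierCoeffs) : Type _ :=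
  A.halfDomain × A.halfDomain × H × H

namespace PhaseSpace

variable {A : StrictlyPositiveOperator H} {c : MGTFourierCoeffs}

noncomputable instance instAddCommGroup : AddCommGroup (PhaseSpace A c) :=
  inferInstanceAs (AddCommGroup (A.halfDomain × A.halfDomain × H × H))

noncomputable instance instModule : Module ℂ (PhaseSpace A c) :=
  inferInstanceAs (Module ℂ (A.halfDomain × A.halfDomain × H × H))

/-- The component `u` of `U = (u, v, w, θ)`. -/
noncomputable def u : PhaseSpace A c →ₗ[ℂ] A.halfDomain :=
  LinearMap.fst ℂ A.halfDomain (A.halfDomain × H × H)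

/-- The component `v` of `U = (u, v, w, θ)`. -/
noncomputable def v : PhaseSpace A c →ₗ[ℂ] A.halfDomain :=
  LinearMap.fst ℂ A.halfDomain (H × H) ∘ₗ LinearMap.snd ℂ A.halfDomain (A.halfDomain × H × H)

/-- The component `w` of `U = (u, v, w, θ)`. -/
noncomputable def w : PhaseSpace A c →ₗ[ℂ] H :=
  LinearMap.fst ℂ H H ∘ₗ LinearMap.snd ℂ A.halfDomain (H × H) ∘ₗ
    LinearMap.snd ℂ A.halfDomain (A.halfDomain × H × H)

/-- The component `θ` of `U = (u, v, w, θ)`. -/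
noncomputable def θ : PhaseSpace A c →ₗ[ℂ] H :=
  LinearMap.snd ℂ H H ∘ₗ LinearMap.snd ℂ A.halfDomain (H × H) ∘ₗ
    LinearMap.snd ℂ A.halfDomain (A.halfDomain × H × H)

/-- The element `(u, v, w, θ)` of the phase space. -/
def mk (u v : A.halfDomain) (w θ : H) : PhaseSpace A c := (u, v, w, θ)

theorem ext {U V : PhaseSpace A c} (h1 : u U = u V) (h2 : v U = v V) (h3 : w U = w V)
    (h4 : θ U = θ V) : U = V :=
  Prod.ext h1 (Prod.ext h2 (Prod.ext h3 h4))

/-- The inner product of the phase space,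
`a²α(β-α)⟪A^½ v₁, A^½ v₂⟫ + a²⟪A^½ u₁ + αA^½ v₁, A^½ u₂ + αA^½ v₂⟫ + ⟪v₁ + αw₁, v₂ + αw₂⟫ + ⟪θ₁, θ₂⟫`,
here conjugate-linear in the first argument. -/
noncomputable def innerProd (U V : PhaseSpace A c) : ℂ :=
  ((c.a ^ 2 * c.α * (c.β - c.α) : ℝ) : ℂ) * inner ℂ (A.half (v U)) (A.half (v V))
  + ((c.a ^ 2 : ℝ) : ℂ) *
      inner ℂ (A.half (u U) + (c.α : ℂ) • A.half (v U)) (A.half (u V) + (c.α : ℂ) • A.half (v V))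
  + inner ℂ ((v U : H) + (c.α : ℂ) • w U) ((v V : H) + (c.α : ℂ) • w V)
  + inner ℂ (θ U) (θ V)

theorem innerProd_self (U : PhaseSpace A c) :
    innerProd U U = ((c.a ^ 2 * c.α * (c.β - c.α) * ‖A.half (v U)‖ ^ 2
      + c.a ^ 2 * ‖A.half (u U) + (c.α : ℂ) • A.half (v U)‖ ^ 2
      + ‖(v U : H) + (c.α : ℂ) • w U‖ ^ 2 + ‖θ U‖ ^ 2 : ℝ) : ℂ) := by
  unfold innerProd
  simp only [inner_self_eq_norm_sq_to_K]
  push_cast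
  rfl

noncomputable instance instCore : InnerProductSpace.Core ℂ (PhaseSpace A c) where
  inner := innerProd
  conj_inner_symm U V := by
    simp only [innerProd, map_add, map_mul, inner_conj_symm, Complex.conj_ofReal]
  re_inner_nonneg U := by
    have h1 := c.α_pos
    have h2 : 0 < c.β - c.α := sub_pos.2 c.α_lt_β
    change 0 ≤ RCLike.re (innerProd U U)
    rw [innerProd_self, RCLike.re_eq_complex_re, Complex.ofReal_re]
    positivity
  add_left U V W := by
    have e1 : ((v (U + V) : A.halfDomain) : H) = (v U : H) + (v V : H) := by simp
    change innerProd (U + V) W = innerProd U W + innerProd V W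
    simp only [innerProd, e1]
    simp only [map_add, smul_add, inner_add_left]
    ring
  smul_left U V r := by
    have e1 : ((v (r • U) : A.halfDomain) : H) = r • (v U : H) := by simp
    change innerProd (r • U) V = _ * innerProd U V
    simp only [innerProd, e1]
    simp only [map_smul, inner_add_left, inner_smul_left, Complex.conj_ofReal]
    ring
  definite U hU := by
    have h1 := c.α_pos
    have h2 : 0 < c.β - c.α := sub_pos.2 c.α_lt_β
    have h3 : 0 < c.a ^ 2 := by have := c.a_ne_zero; positivity
    change innerProd U U = 0 at hU
    rw [innerProd_self, Complex.ofReal_eq_zero] at hU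
    have p1 : 0 < c.a ^ 2 * c.α * (c.β - c.α) := by positivity
    have q1 : 0 ≤ c.a ^ 2 * c.α * (c.β - c.α) * ‖A.half (v U)‖ ^ 2 := by positivity
    have q2 : 0 ≤ c.a ^ 2 * ‖A.half (u U) + (c.α : ℂ) • A.half (v U)‖ ^ 2 := by positivity
    have q3 : 0 ≤ ‖(v U : H) + (c.α : ℂ) • w U‖ ^ 2 := by positivity
    have q4 : 0 ≤ ‖θ U‖ ^ 2 := by positivity
    have r1 : A.half (v U) = 0 := by
      have : c.a ^ 2 * c.α * (c.β - c.α) * ‖A.half (v U)‖ ^ 2 = 0 := by linarith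
      simpa [p1.ne'] using this
    have r2 : A.half (u U) = 0 := by
      have : c.a ^ 2 * ‖A.half (u U) + (c.α : ℂ) • A.half (v U)‖ ^ 2 = 0 := by linarith
      simpa [h3.ne', r1, c.a_ne_zero] using this
    have s1 : v U = 0 := A.half_injective _ r1
    have s2 : u U = 0 := A.half_injective _ r2
    have s3 : w U = 0 := by
      have : ‖(v U : H) + (c.α : ℂ) • w U‖ ^ 2 = 0 := by linarith
      simpa [s1, h1.ne'] using this
    have s4 : θ U = 0 := by
      have : ‖θ U‖ ^ 2 = 0 := by linarith
      simpa using this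
    apply PhaseSpace.ext <;> simp [s1, s2, s3, s4]

noncomputable instance instNormedAddCommGroup : NormedAddCommGroup (PhaseSpace A c) :=
  instCore.toNormedAddCommGroup

noncomputable instance instInnerProductSpace : InnerProductSpace ℂ (PhaseSpace A c) :=
  InnerProductSpace.ofCore instCore.toCore

end PhaseSpace

open PhaseSpace

variable (A : StrictlyPositiveOperator H) (c : MGTFourierCoeffs) (φ : ℝ)

/-- `U ↦ a²u + a²βv - ηA^(φ-1)θ`. -/
noncomputable def stress : PhaseSpace A c →ₗ[ℂ] H :=
  ((c.a ^ 2 : ℝ) : ℂ) • (A.halfDomain.subtype ∘ₗ u)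
    + ((c.a ^ 2 * c.β : ℝ) : ℂ) • (A.halfDomain.subtype ∘ₗ v)
    - (c.η : ℂ) • ((A.negPow (1 - φ)).toLinearMap ∘ₗ θ)

/-- `U ↦ ηA^(φ-1)v + αηA^(φ-1)w + θ`. -/
noncomputable def flux : PhaseSpace A c →ₗ[ℂ] H :=
  (c.η : ℂ) • ((A.negPow (1 - φ)).toLinearMap ∘ₗ A.halfDomain.subtype ∘ₗ v)
    + ((c.α * c.η : ℝ) : ℂ) • ((A.negPow (1 - φ)).toLinearMap ∘ₗ w)
    + θ

/-- The operator `𝔹` of the first-order system, for `0 ≤ φ ≤ 1`. Its domain is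
`{U : w ∈ D(A^½), a²u + a²βv - ηA^(φ-1)θ ∈ D(A), ηA^(φ-1)v + αηA^(φ-1)w + θ ∈ D(A)}`
(that `v ∈ D(A^½)` is part of the phase space), and there
`𝔹U = (v, w, -α⁻¹(A(a²u + a²βv - ηA^(φ-1)θ) + w), -A(ηA^(φ-1)v + αηA^(φ-1)w + θ))`. -/
noncomputable def opB : PhaseSpace A c →ₗ.[ℂ] PhaseSpace A c where
  domain := A.halfDomain.comap w ⊓ A.toLinearPMap.domain.comap (stress A c φ)
    ⊓ A.toLinearPMap.domain.comap (flux A c φ)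
  toFun :=
    { toFun := fun U => PhaseSpace.mk (v U.1) ⟨w U.1, U.2.1.1⟩
        (-((c.α : ℂ)⁻¹ • (A.toLinearPMap ⟨stress A c φ U.1, U.2.1.2⟩ + w U.1)))
        (-A.toLinearPMap ⟨flux A c φ U.1, U.2.2⟩)
      map_add' := fun U V => by
        have e1 : A.toLinearPMap ⟨stress A c φ (U + V).1, (U + V).2.1.2⟩
            = A.toLinearPMap ⟨stress A c φ U.1, U.2.1.2⟩
              + A.toLinearPMap ⟨stress A c φ V.1, V.2.1.2⟩ := by
          rw [← LinearPMap.map_add]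
          congr 1
          exact Subtype.ext (map_add (stress A c φ) U.1 V.1)
        have e2 : A.toLinearPMap ⟨flux A c φ (U + V).1, (U + V).2.2⟩
            = A.toLinearPMap ⟨flux A c φ U.1, U.2.2⟩
              + A.toLinearPMap ⟨flux A c φ V.1, V.2.2⟩ := by
          rw [← LinearPMap.map_add]
          congr 1
          exact Subtype.ext (map_add (flux A c φ) U.1 V.1)
        have e3 : w (U + V).1 = w U.1 + w V.1 := map_add w U.1 V.1
        refine PhaseSpace.ext ?_ ?_ ?_ ?_
        · exact map_add v U.1 V.1
        · exact Subtype.ext e3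
        · change -((c.α : ℂ)⁻¹ • (A.toLinearPMap ⟨stress A c φ (U + V).1, _⟩ + w (U + V).1))
            = -((c.α : ℂ)⁻¹ • (A.toLinearPMap ⟨stress A c φ U.1, _⟩ + w U.1))
              + -((c.α : ℂ)⁻¹ • (A.toLinearPMap ⟨stress A c φ V.1, _⟩ + w V.1))
          rw [e1, e3]
          module
        · change -A.toLinearPMap ⟨flux A c φ (U + V).1, _⟩
            = -A.toLinearPMap ⟨flux A c φ U.1, _⟩ + -A.toLinearPMap ⟨flux A c φ V.1, _⟩
          rw [e2]
          abel
      map_smul' := fun r U => by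
        have e1 : A.toLinearPMap ⟨stress A c φ (r • U).1, (r • U).2.1.2⟩
            = r • A.toLinearPMap ⟨stress A c φ U.1, U.2.1.2⟩ := by
          rw [← LinearPMap.map_smul]
          congr 1
          exact Subtype.ext (map_smul (stress A c φ) r U.1)
        have e2 : A.toLinearPMap ⟨flux A c φ (r • U).1, (r • U).2.2⟩
            = r • A.toLinearPMap ⟨flux A c φ U.1, U.2.2⟩ := by
          rw [← LinearPMap.map_smul]
          congr 1
          exact Subtype.ext (map_smul (flux A c φ) r U.1)
        have e3 : w (r • U).1 = r • w U.1 := map_smul w r U.1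
        refine PhaseSpace.ext ?_ ?_ ?_ ?_
        · exact map_smul v r U.1
        · exact Subtype.ext e3
        · change -((c.α : ℂ)⁻¹ • (A.toLinearPMap ⟨stress A c φ (r • U).1, _⟩ + w (r • U).1))
            = r • -((c.α : ℂ)⁻¹ • (A.toLinearPMap ⟨stress A c φ U.1, _⟩ + w U.1))
          rw [e1, e3]
          module
        · change -A.toLinearPMap ⟨flux A c φ (r • U).1, _⟩
            = r • -A.toLinearPMap ⟨flux A c φ U.1, _⟩
          rw [e2, smul_neg] }

end MGTFourier

/-!
Write `L = A^(-½)`. In the energy coordinates `p = A^½(u + αv)`, `q = A^½ v`, `r = v + αw`, `θ` the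
system with `φ = 1` reads
`p' = L⁻¹r`, `q' = (L⁻¹r - q)/α`, `r' = -a²L⁻¹p - a²(β-α)L⁻¹q + ηL⁻²θ`, `θ' = -L⁻²(ηr + θ)`.
The operator has an explicit bounded inverse (`mem_graph_opB_one_iff`). Put `y = L⁻¹r` and
`t = L⁻¹θ`. In the energy inner product the form of the operator has real part
`-a²(β-α)‖q‖² - ‖t‖²` (`re_inner_opBInv_nonpos`), so the operator is dissipative.

At high frequency the pair `(r, θ)` is driven by `A` times the matrix with rows `(0, η)` and
`(-η, -1)`, whose eigenvalues have negative real part because `η ≠ 0`. Adding the cross term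
`κ(⟪r, θ⟫ + ⟪θ, r⟫)`, `κ = η/(1+η²)`, to the inner product therefore makes the form coercive in `y`
and `t`, while `p` and `q` enter only through terms of lower order, and only `‖p‖² + ‖q‖²` has to be
compensated by a shift. The form is bounded on the same space, so a shift of the operator is
sectorial for this equivalent inner product (`exists_sectorial_bound`).

The rest is the generation theorem `exists_analytic_contraction_semigroup` for an operator with a
bounded inverse `J`. The Yosida approximations `-n(1 - nJ)⁻¹` inherit the sectorial bound, so their
exponentials are uniformly bounded on a complex sector and converge there, locally uniformly, to the
semigroup. Since `J` commutes with the semigroup, the generator is exactly `J⁻¹`. Strong holomorphy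
upgrades to holomorphy in norm by Cauchy's formula, and the contraction bound in the energy norm
follows from dissipativity by differentiating `‖S(t)x‖²` at `t > 0`, which analyticity permits.
-/

/-! ### Exponentials of bounded dissipative operators -/

section Dissipative

variable {X Y : Type*} [NormedAddCommGroup X] [InnerProductSpace ℂ X] [CompleteSpace X]
  [NormedAddCommGroup Y] [InnerProductSpace ℂ Y]

theorem hasDerivAt_exp_ofReal_smul_apply (G : X →L[ℂ] X) (x : X) (t : ℝ) :
    HasDerivAt (fun s : ℝ => NormedSpace.exp ((s : ℂ) • G) x)
      (G (NormedSpace.exp ((t : ℂ) • G) x)) t := by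
  have h := HasDerivAt.scomp t (hasDerivAt_exp_smul_const' (𝕂 := ℂ) G (t : ℂ))
    Complex.ofRealCLM.hasDerivAt
  have h2 := ((ContinuousLinearMap.apply ℂ X x).restrictScalars ℝ).hasFDerivAt.comp_hasDerivAt t h
  refine h2.congr_deriv ?_
  simp

/-- The norm `‖Q ·‖` does not grow under `exp G`, if `G` is dissipative for the inner product
`⟪Q ·, Q ·⟫`. -/
theorem norm_map_exp_apply_le (G : X →L[ℂ] X) (Q : X →L[ℂ] Y)
    (h : ∀ x, (inner ℂ (Q x) (Q (G x))).re ≤ 0) (x : X) :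
    ‖Q (NormedSpace.exp G x)‖ ≤ ‖Q x‖ := by
  have hd (t : ℝ) : HasDerivAt (fun s : ℝ => Q (NormedSpace.exp ((s : ℂ) • G) x))
      (Q (G (NormedSpace.exp ((t : ℂ) • G) x))) t :=
    (Q.restrictScalars ℝ).hasFDerivAt.comp_hasDerivAt t (hasDerivAt_exp_ofReal_smul_apply G x t)
  let _ : InnerProductSpace ℝ Y := InnerProductSpace.rclikeToReal ℂ Y
  have ha : Antitone (fun s : ℝ => ‖Q (NormedSpace.exp ((s : ℂ) • G) x)‖ ^ 2) := by
    refine antitone_of_hasDerivAt_nonpos (fun t => (hd t).norm_sq) fun t => ?_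
    have := h (NormedSpace.exp ((t : ℂ) • G) x)
    rw [real_inner_eq_re_inner ℂ]
    change 2 * (inner ℂ (Q _) (Q (G _))).re ≤ 0
    linarith
  have := ha zero_le_one
  simp only [Complex.ofReal_one, one_smul, Complex.ofReal_zero, zero_smul,
    NormedSpace.exp_zero, one_apply_eq_self] at this
  exact le_of_sq_le_sq this (norm_nonneg _)

/-- Duhamel's estimate for commuting `F` and `G` that generate groups bounded by `M` on `[0, 1]`. -/
theorem norm_exp_apply_sub_exp_apply_le {F G : X →L[ℂ] X} (hFG : Commute F G) {M : ℝ}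
    (hF : ∀ s : ℝ, 0 ≤ s → ∀ x, ‖NormedSpace.exp ((s : ℂ) • F) x‖ ≤ M * ‖x‖)
    (hG : ∀ s : ℝ, 0 ≤ s → ∀ x, ‖NormedSpace.exp ((s : ℂ) • G) x‖ ≤ M * ‖x‖) (hM : 0 ≤ M) (x : X) :
    ‖NormedSpace.exp F x - NormedSpace.exp G x‖ ≤ M * (M * ‖F x - G x‖) := by
  -- The path `exp (s F) exp ((1 - s) G) x` from `exp G x` to `exp F x`.
  have hd (t : ℝ) : HasDerivAt
      (fun s : ℝ => NormedSpace.exp ((s : ℂ) • F) (NormedSpace.exp (((1 - s : ℝ) : ℂ) • G) x))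
      (NormedSpace.exp ((t : ℂ) • F) (NormedSpace.exp (((1 - t : ℝ) : ℂ) • G) (F x - G x))) t := by
    have h1 := HasDerivAt.scomp t (hasDerivAt_exp_smul_const (𝕂 := ℂ) F (t : ℂ))
      Complex.ofRealCLM.hasDerivAt
    have h3 := HasDerivAt.scomp t (hasDerivAt_exp_smul_const (𝕂 := ℂ) G ((1 - t : ℝ) : ℂ))
      ((hasDerivAt_id t).const_sub 1).ofReal_comp
    have h4 := ((ContinuousLinearMap.apply ℂ X x).restrictScalars ℝ).hasFDerivAt.comp_hasDerivAt
      t (h1.mul h3)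
    refine h4.congr_deriv ?_
    have hc : Commute F (NormedSpace.exp (((1 - t : ℝ) : ℂ) • G)) :=
      (hFG.smul_right _).exp_right
    have hc' := DFunLike.congr_fun hc.eq x
    simp only [mul_apply_eq_comp] at hc'
    simp only [Complex.ofRealCLM_apply, Complex.ofReal_one, one_smul, Complex.ofReal_neg, neg_smul,
      mul_neg, id, Function.comp_apply]
    simp only [ContinuousLinearMap.coe_restrictScalars', ContinuousLinearMap.apply_apply,
      mul_apply_eq_comp, map_sub, hc', ← sub_eq_add_neg]
  have := norm_image_sub_le_of_norm_deriv_le_segment_01' (C := M * (M * ‖F x - G x‖))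
    (fun t _ => (hd t).hasDerivWithinAt) fun t ht =>
      (hF t ht.1 _).trans (mul_le_mul_of_nonneg_left (hG (1 - t) (by linarith [ht.2]) _) hM)
  simpa using this

end Dissipative

/-! ### Yosida approximation from a bounded inverse -/

section Yosida

variable {X : Type*} [NormedAddCommGroup X] [InnerProductSpace ℂ X]

theorem inner_self_eq_ofReal_norm_sq (x : X) : (inner ℂ x x : ℂ) = ((‖x‖ ^ 2 : ℝ) : ℂ) := by
  rw [inner_self_eq_norm_sq_to_K]; norm_cast

theorem norm_le_norm_sub_smul {J : X →L[ℂ] X} (hJ : ∀ f, (inner ℂ (J f) f).re ≤ 0) {s : ℝ}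
    (hs : 0 ≤ s) (f : X) : ‖f‖ ≤ ‖f - (s : ℂ) • J f‖ := by
  have h1 : (inner ℂ f f : ℂ).re = ‖f‖ ^ 2 := by
    rw [inner_self_eq_ofReal_norm_sq, Complex.ofReal_re]
  have h2 := mul_nonpos_of_nonneg_of_nonpos hs (hJ f)
  have h3 := re_inner_le_norm (𝕜 := ℂ) (f - (s : ℂ) • J f) f
  simp only [inner_sub_left, inner_smul_left, Complex.conj_ofReal, RCLike.re_eq_complex_re,
    Complex.sub_re, Complex.re_ofReal_mul, h1] at h3
  by_contra! h
  nlinarith [norm_nonneg f, norm_nonneg (f - (s : ℂ) • J f)]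

theorem commute_ringInverse_right {R : Type*} [MonoidWithZero R] {a b : R} (h : Commute a b) :
    Commute a (Ring.inverse b) := by
  by_cases hb : IsUnit b
  · obtain ⟨u, rfl⟩ := hb
    rw [Ring.inverse_unit]
    exact h.units_inv_right
  · rw [Ring.inverse_non_unit _ hb]
    exact Commute.zero_right a

/-- The Yosida approximation `n B (n - B)⁻¹` of `B = J⁻¹`, which equals `-n (1 - n J)⁻¹`. -/
noncomputable def yosida (J : X →L[ℂ] X) (n : ℕ) : X →L[ℂ] X :=
  -((n : ℂ) • Ring.inverse (1 - (n : ℂ) • J))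

theorem commute_yosida_left (J : X →L[ℂ] X) (n : ℕ) : Commute J (yosida J n) := by
  have : Commute J (1 - (n : ℂ) • J) :=
    (Commute.one_right J).sub_right ((Commute.refl J).smul_right _)
  exact ((commute_ringInverse_right this).smul_right _).neg_right

theorem commute_yosida_yosida (J : X →L[ℂ] X) (m n : ℕ) :
    Commute (yosida J m) (yosida J n) := by
  have : Commute (1 - (m : ℂ) • J) (yosida J n) :=
    (Commute.one_left _).sub_left ((commute_yosida_left J n).smul_left _)
  exact ((commute_ringInverse_right this.symm).symm.smul_left _).neg_left

variable [CompleteSpace X]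

theorem isUnit_one_sub_smul {J : X →L[ℂ] X} (hJ : ∀ f, (inner ℂ (J f) f).re ≤ 0) {s : ℝ}
    (hs : 0 ≤ s) : IsUnit (1 - (s : ℂ) • J) := by
  refine ContinuousLinearMap.isUnit_of_forall_le_norm_inner_map _ (c := 1) one_pos fun f => ?_
  refine le_trans ?_ (Complex.re_le_norm _)
  have h1 : (inner ℂ f f : ℂ).re = ‖f‖ ^ 2 := by
    rw [inner_self_eq_ofReal_norm_sq, Complex.ofReal_re]
  have h2 := mul_nonpos_of_nonneg_of_nonpos hs (hJ f)
  simp only [NNReal.coe_one, mul_one, sub_apply, one_apply_eq_self,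
    smul_apply, inner_sub_left, inner_smul_left, Complex.conj_ofReal,
    Complex.sub_re, Complex.re_ofReal_mul, h1]
  linarith

/-- The range of an injective dissipative bounded operator is dense. -/
theorem denseRange_of_injective_of_dissipative {J : X →L[ℂ] X}
    (hJ : ∀ f, (inner ℂ (J f) f).re ≤ 0) (hi : Function.Injective J) : DenseRange J := by
  have : J.range.topologicalClosure = ⊤ := by
    rw [Submodule.topologicalClosure_eq_top_iff, Submodule.eq_bot_iff]
    intro g hg
    have hg' (f : X) : inner ℂ (J f) g = 0 := (Submodule.mem_orthogonal _ _).1 hg _ ⟨f, rfl⟩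
    -- Dissipativity at `g + t J g` for small `t > 0` forces `J g = 0`.
    have key (t : ℝ) (ht : 0 < t) :
        ‖J g‖ ^ 2 + t * (inner ℂ (J (J g)) (J g)).re ≤ 0 := by
      have h := hJ (g + (t : ℂ) • J g)
      have h1 : (inner ℂ (J g) (J g) : ℂ).re = ‖J g‖ ^ 2 := by
        rw [inner_self_eq_ofReal_norm_sq, Complex.ofReal_re]
      simp only [map_add, map_smul, inner_add_left, inner_add_right, inner_smul_left,
        inner_smul_right, hg', Complex.conj_ofReal, Complex.add_re, Complex.re_ofReal_mul,
        h1, mul_zero, zero_add, add_zero] at h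
      nlinarith
    have hz : ‖J g‖ ^ 2 ≤ 0 := by
      have hc : Tendsto (fun t : ℝ => ‖J g‖ ^ 2 + t * (inner ℂ (J (J g)) (J g)).re) (𝓝[>] 0)
          (𝓝 (‖J g‖ ^ 2 + 0 * (inner ℂ (J (J g)) (J g)).re)) :=
        ((continuous_const.add (continuous_id.mul continuous_const)).tendsto 0).mono_left
          nhdsWithin_le_nhds
      have := le_of_tendsto hc (eventually_mem_nhdsWithin.mono fun t ht => key t ht)
      simpa using this
    have : J g = 0 := by
      have := le_antisymm hz (by positivity)
      simpa using this
    exact hi (by simpa using this)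
  exact (Submodule.dense_iff_topologicalClosure_eq_top.2 this)

variable {J : X →L[ℂ] X}

theorem yosida_apply_sub (hJ : ∀ f, (inner ℂ (J f) f).re ≤ 0) (n : ℕ) (x : X) :
    yosida J n x - (n : ℂ) • J (yosida J n x) = -((n : ℂ) • x) := by
  have hu := isUnit_one_sub_smul hJ (Nat.cast_nonneg n)
  rw [Complex.ofReal_natCast] at hu
  have h := DFunLike.congr_fun (Ring.mul_inverse_cancel _ hu) x
  simp only [mul_apply_eq_comp, sub_apply,
    one_apply_eq_self, smul_apply] at h
  conv_rhs => rw [← h]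
  simp only [yosida, neg_apply, smul_apply, map_neg,
    map_smul, smul_sub, smul_neg]
  abel

/-- The Yosida approximations converge to `B = J⁻¹` on the range of `J`. -/
theorem tendsto_yosida_apply (hJ : ∀ f, (inner ℂ (J f) f).re ≤ 0) (hd : DenseRange J) (f : X) :
    Tendsto (fun n => yosida J n (J f)) atTop (𝓝 f) := by
  -- The error `e` solves `(1 - n J) e = -f`; it is bounded by `‖f‖`, and by `2 ‖h‖ / n` if `f = J h`.
  have he (n : ℕ) (f : X) : ‖yosida J n (J f) - f‖ ≤ ‖f‖ := by
    have h := yosida_apply_sub hJ n (J f)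
    refine (norm_le_norm_sub_smul hJ (Nat.cast_nonneg n) _).trans (le_of_eq ?_)
    rw [← norm_neg f]
    congr 1
    rw [Complex.ofReal_natCast, map_sub]
    linear_combination (norm := module) h
  have he' (n : ℕ) (h : X) : n * ‖yosida J n (J (J h)) - J h‖ ≤ 2 * ‖h‖ := by
    have h0 := yosida_apply_sub hJ n (J (J h))
    have h1 : ‖(n : ℂ) • (yosida J n (J (J h)) - J h) - h‖ ≤ ‖h‖ := by
      refine (norm_le_norm_sub_smul hJ (Nat.cast_nonneg n) _).trans (le_of_eq ?_)
      rw [← norm_neg h]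
      congr 1
      rw [Complex.ofReal_natCast, map_sub, map_smul, map_sub]
      linear_combination (norm := module) (n : ℂ) • h0
    have h2 : ‖(n : ℂ) • (yosida J n (J (J h)) - J h)‖ ≤ ‖h‖ + ‖h‖ :=
      (norm_le_norm_sub_add _ h).trans (by linarith)
    rw [norm_smul, Complex.norm_natCast] at h2
    linarith
  rw [Metric.tendsto_atTop]
  intro ε hε
  obtain ⟨h, hh⟩ := hd.exists_dist_lt f (half_pos hε)
  obtain ⟨N, hN⟩ := exists_nat_gt (2 * ‖h‖ / (ε / 2))
  have hN0 : (0 : ℝ) < N := lt_of_le_of_lt (by positivity) hN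
  refine ⟨N, fun n hn => ?_⟩
  have hn' : (N : ℝ) ≤ n := by exact_mod_cast hn
  have h1 := he n (f - J h)
  have h2 : ‖yosida J n (J (J h)) - J h‖ < ε / 2 := by
    rw [div_lt_iff₀ (by positivity)] at hN
    by_contra! hc
    nlinarith [he' n h]
  rw [dist_eq_norm] at hh ⊢
  calc ‖yosida J n (J f) - f‖
      = ‖(yosida J n (J (f - J h)) - (f - J h)) + (yosida J n (J (J h)) - J h)‖ := by
        congr 1; simp only [map_sub]; abel
    _ ≤ _ := norm_add_le _ _
    _ < ε := by linarith

end Yosida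

/-! ### Operator-norm holomorphy -/

section Holomorphy

variable {X : Type*} [NormedAddCommGroup X] [NormedSpace ℂ X] [CompleteSpace X]

/-- A bounded, strongly holomorphic family of operators is holomorphic in operator norm: by Cauchy's
estimate it is locally Lipschitz in norm, so Cauchy's formula for its orbits is an identity between
operator-valued integrals. -/
theorem differentiableOn_of_forall_differentiableOn_apply {T : ℂ → X →L[ℂ] X} {U : Set ℂ}
    (hU : IsOpen U) {M : ℝ} (hM : ∀ z ∈ U, ‖T z‖ ≤ M)
    (h : ∀ x, DifferentiableOn ℂ (fun z => T z x) U) : DifferentiableOn ℂ T U := by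
  intro c hc
  obtain ⟨r, hr, hrU⟩ := Metric.nhds_basis_closedBall.mem_iff.1 (hU.mem_nhds hc)
  obtain ⟨R, hR, rfl⟩ : ∃ R : ℝ, 0 < R ∧ r = R + R := ⟨r / 2, by positivity, by ring⟩
  have hdist (z : ℂ) (hz : z ∈ Metric.closedBall c R) : Metric.closedBall z R ⊆ U := fun w hw =>
    hrU (by
      rw [Metric.mem_closedBall] at *
      linarith [dist_triangle w z c])
  have hmem (z : ℂ) (hz : z ∈ Metric.closedBall c R) : z ∈ U :=
    hdist z hz (Metric.mem_closedBall_self hR.le)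
  have hlip (z : ℂ) (hz : z ∈ Metric.closedBall c R) (w : ℂ) (hw : w ∈ Metric.closedBall c R) :
      ‖T w - T z‖ ≤ M / R * ‖w - z‖ := by
    have hM0 : 0 ≤ M := (norm_nonneg _).trans (hM c hc)
    refine ContinuousLinearMap.opNorm_le_bound _ (by positivity) fun x => ?_
    have := (convex_closedBall c R).norm_image_sub_le_of_norm_deriv_le (𝕜 := ℂ)
      (f := fun z => T z x) (C := M * ‖x‖ / R)
      (fun y hy => (h x).differentiableAt (hU.mem_nhds (hmem y hy)))
      (fun y hy => by
        refine Complex.norm_deriv_le_of_forall_mem_sphere_norm_le hR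
          (((h x).mono (hdist y hy)).diffContOnCl_ball subset_rfl) fun v hv => ?_
        exact (T v).le_of_opNorm_le (hM v (hdist y hy (Metric.sphere_subset_closedBall hv))) x)
      hz hw
    refine this.trans (le_of_eq ?_)
    ring
  have hcont : ContinuousOn T (Metric.closedBall c R) :=
    (LipschitzOnWith.of_dist_le_mul (K := (M / R).toNNReal) fun w hw z hz => by
      rw [dist_eq_norm, dist_eq_norm]
      exact (hlip z hz w hw).trans
        (mul_le_mul_of_nonneg_right (Real.le_coe_toNNReal _) (norm_nonneg _))).continuousOn
  lift R to NNReal using hR.le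
  have hcirc : CircleIntegrable T c R :=
    (hcont.mono Metric.sphere_subset_closedBall).circleIntegrable R.2
  have hF := hasFPowerSeriesOn_cauchy_integral hcirc (by exact_mod_cast hR)
  refine (hF.analyticAt.differentiableAt.congr_of_eventuallyEq ?_).differentiableWithinAt
  filter_upwards [Metric.ball_mem_nhds c hR] with w hw
  ext x
  have hx := (((h x).mono (hdist c (Metric.mem_closedBall_self
    hR.le))).diffContOnCl_ball subset_rfl).two_pi_i_inv_smul_circleIntegral_sub_inv_smul hw
  rw [← hx, smul_apply]
  congr 1
  have hint : CircleIntegrable (fun z => (z - w)⁻¹ • T z) c R := by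
    refine ContinuousOn.circleIntegrable R.2 (ContinuousOn.fun_smul ?_
      (hcont.mono Metric.sphere_subset_closedBall))
    refine ContinuousOn.inv₀ (by fun_prop) fun z hz => sub_ne_zero.2 ?_
    rintro rfl
    exact (Metric.mem_ball.1 hw).ne (Metric.mem_sphere.1 hz)
  exact ((ContinuousLinearMap.apply ℂ X x).intervalIntegral_comp_comm hint.out)

end Holomorphy

/-! ### Semigroups on a sector -/

section Sector

/-- The closed convex cone `{z : C |Im z| ≤ Re z}`, which is a sector of half-angle `arctan C⁻¹` if
`C > 0`. -/
def sectorCone (C : ℝ) : Set ℂ := {z | C * |z.im| ≤ z.re}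

theorem zero_mem_sectorCone (C : ℝ) : 0 ∈ sectorCone C := by simp [sectorCone]

theorem ofReal_mem_sectorCone (C : ℝ) {t : ℝ} (ht : 0 ≤ t) : (t : ℂ) ∈ sectorCone C := by
  simpa [sectorCone] using ht

theorem add_mem_sectorCone {C : ℝ} (hC : 0 ≤ C) {z w : ℂ} (hz : z ∈ sectorCone C)
    (hw : w ∈ sectorCone C) : z + w ∈ sectorCone C := by
  simp only [sectorCone, Set.mem_ofPred_eq, Complex.add_im, Complex.add_re] at *
  nlinarith [mul_le_mul_of_nonneg_left (abs_add_le z.im w.im) hC]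

theorem smul_mem_sectorCone {C : ℝ} {z : ℂ} (hz : z ∈ sectorCone C) {s : ℝ} (hs : 0 ≤ s) :
    (s : ℂ) * z ∈ sectorCone C := by
  simp only [sectorCone, Set.mem_ofPred_eq, Complex.re_ofReal_mul, Complex.im_ofReal_mul, abs_mul,
    abs_of_nonneg hs] at *
  nlinarith [mul_le_mul_of_nonneg_left hz hs]

theorem isOpen_openSector {ϑ : ℝ} (hϑ : ϑ < Real.pi / 2) : IsOpen (openSector ϑ) := by
  rw [isOpen_iff_mem_nhds]
  rintro z ⟨hz0, hz⟩
  have hs : z ∈ Complex.slitPlane := by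
    rcases Complex.abs_arg_lt_pi_div_two_iff.1 (hz.trans hϑ) with h | h
    · exact Or.inl h
    · exact absurd h hz0
  filter_upwards [isOpen_ne.mem_nhds hz0,
    (Complex.continuousAt_arg hs).abs.eventually_lt_const hz] with w h1 h2
  exact ⟨h1, h2⟩

theorem openSector_subset_sectorCone {C : ℝ} (hC : 0 < C) :
    openSector (Real.arctan C⁻¹) ⊆ sectorCone C := by
  rintro z ⟨hz0, hz⟩
  have hre : 0 < z.re := by
    rcases Complex.abs_arg_lt_pi_div_two_iff.1 (hz.trans (Real.arctan_lt_pi_div_two _)) with h | h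
    · exact h
    · exact absurd h hz0
  obtain ⟨h1, h2⟩ := abs_lt.1 hz
  have hb := Real.arctan_lt_pi_div_two C⁻¹
  have h3 := Real.tan_lt_tan_of_lt_of_lt_pi_div_two (by linarith) hb h2
  have h4 := Real.tan_lt_tan_of_lt_of_lt_pi_div_two (by linarith) (by linarith) h1
  rw [Real.tan_neg] at h4
  rw [Real.tan_arctan, Complex.tan_arg] at h3 h4
  have h5 : |z.im / z.re| < C⁻¹ := abs_lt.2 ⟨h4, h3⟩
  rw [abs_div, abs_of_pos hre, div_lt_iff₀ hre, inv_mul_eq_div, lt_div_iff₀ hC] at h5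
  change C * |z.im| ≤ z.re
  linarith

end Sector

section TrotterKato

variable {X : Type*} [NormedAddCommGroup X] [InnerProductSpace ℂ X] [CompleteSpace X]

/-- Bounded commuting generators that converge on a dense set, and whose groups are uniformly bounded
on the cone, have groups that converge strongly, locally uniformly on the cone. -/
theorem exists_tendstoUniformlyOn_exp {G : ℕ → X →L[ℂ] X} (hG : ∀ m n, Commute (G m) (G n))
    {C M : ℝ} (hM : ∀ n, ∀ z ∈ sectorCone C, ∀ x, ‖NormedSpace.exp (z • G n) x‖ ≤ M * ‖x‖)
    (hM0 : 0 ≤ M) {D : Set X} (hD : Dense D) (hconv : ∀ x ∈ D, ∃ y, Tendsto (G · x) atTop (𝓝 y)) :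
    ∃ T : ℂ → X →L[ℂ] X, ∀ (R : ℝ) (x : X), TendstoUniformlyOn
      (fun n z => NormedSpace.exp (z • G n) x) (fun z => T z x) atTop
      (sectorCone C ∩ Metric.closedBall 0 R) := by
  have hcau (R : ℝ) (x : X) : UniformCauchySeqOn (fun n z => NormedSpace.exp (z • G n) x) atTop
      (sectorCone C ∩ Metric.closedBall 0 R) := by
    rw [Metric.uniformCauchySeqOn_iff]
    intro ε hε
    obtain ⟨d, hd, hxd⟩ := hD.exists_dist_lt x (show 0 < ε / (4 * (M + 1)) by positivity)
    obtain ⟨y, hy⟩ := hconv d hd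
    obtain ⟨N, hN⟩ := Metric.cauchySeq_iff.1 hy.cauchySeq (ε / (2 * (M * (M * |R|) + 1)))
      (by positivity)
    refine ⟨N, fun m hm n hn z hz => ?_⟩
    have hNmn := hN m hm n hn
    rw [dist_eq_norm] at hxd hNmn ⊢
    have hsz (k : ℕ) (s : ℝ) (hs : 0 ≤ s) (x : X) :
        ‖NormedSpace.exp ((s : ℂ) • z • G k) x‖ ≤ M * ‖x‖ := by
      rw [smul_smul]
      exact hM k _ (smul_mem_sectorCone hz.1 hs) x
    have h1 := norm_exp_apply_sub_exp_apply_le (((hG m n).smul_left z).smul_right z)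
      (hsz m) (hsz n) hM0 d
    have h2 : ‖(z • G m) d - (z • G n) d‖ ≤ |R| * ‖G m d - G n d‖ := by
      rw [smul_apply, smul_apply, ← smul_sub, norm_smul]
      have : ‖z‖ ≤ R := by simpa using hz.2
      gcongr
      exact this.trans (le_abs_self R)
    have h3 := hM m z hz.1 (x - d)
    have h4 := hM n z hz.1 (x - d)
    have h5 : M * ‖x - d‖ ≤ ε / 4 := by
      rw [lt_div_iff₀ (by positivity)] at hxd
      nlinarith [norm_nonneg (x - d)]
    have h6 : M * (M * ‖(z • G m) d - (z • G n) d‖) < ε / 2 := by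
      rw [lt_div_iff₀ (by positivity)] at hNmn
      have : M * (M * ‖(z • G m) d - (z • G n) d‖) ≤ M * (M * (|R| * ‖G m d - G n d‖)) := by
        gcongr
      by_cases h0 : ‖G m d - G n d‖ = 0
      · rw [h0] at this
        simp only [mul_zero] at this
        linarith
      · have : 0 < ‖G m d - G n d‖ := lt_of_le_of_ne (norm_nonneg _) (Ne.symm h0)
        nlinarith
    calc ‖NormedSpace.exp (z • G m) x - NormedSpace.exp (z • G n) x‖
        = ‖NormedSpace.exp (z • G m) (x - d) - NormedSpace.exp (z • G n) (x - d)
            + (NormedSpace.exp (z • G m) d - NormedSpace.exp (z • G n) d)‖ := by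
          congr 1; simp only [map_sub]; abel
      _ ≤ ‖NormedSpace.exp (z • G m) (x - d)‖ + ‖NormedSpace.exp (z • G n) (x - d)‖
            + ‖NormedSpace.exp (z • G m) d - NormedSpace.exp (z • G n) d‖ :=
          (norm_add_le _ _).trans (add_le_add_left (norm_sub_le _ _) _)
      _ < ε := by linarith
  have hlim (z : ℂ) : ∃ S : X →L[ℂ] X, z ∈ sectorCone C →
      ∀ x, Tendsto (fun n => NormedSpace.exp (z • G n) x) atTop (𝓝 (S x)) := by
    by_cases hz : z ∈ sectorCone C
    · have (x : X) : ∃ y, Tendsto (fun n => NormedSpace.exp (z • G n) x) atTop (𝓝 y) :=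
        cauchySeq_tendsto_of_complete ((hcau ‖z‖ x).cauchySeq ⟨hz, by simp⟩)
      choose f hf using this
      exact ⟨continuousLinearMapOfTendsto _ (tendsto_pi_nhds.2 hf), fun _ => hf⟩
    · exact ⟨0, fun h => absurd h hz⟩
  choose T hT using hlim
  exact ⟨T, fun R x => (hcau R x).tendstoUniformlyOn_of_tendsto fun z hz => hT z hz.1 x⟩

end TrotterKato

/-! ### Generation of an analytic semigroup by an operator with a bounded inverse -/

section Generation

variable {X Y : Type*} [NormedAddCommGroup X] [InnerProductSpace ℂ X] [CompleteSpace X]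
  [NormedAddCommGroup Y] [InnerProductSpace ℂ Y]

/-- The Yosida approximations inherit the sectorial bound of `J⁻¹` for the inner product
`⟪Q ·, Q ·⟫`. -/
theorem re_mul_inner_yosida_nonpos {J : X →L[ℂ] X} (hJ : ∀ f, (inner ℂ (J f) f).re ≤ 0)
    (Q : X →L[ℂ] Y) {z : ℂ} (hz0 : 0 ≤ z.re)
    (hz : ∀ f, (z * inner ℂ (Q (J f)) (Q f)).re ≤ 0) (n : ℕ) (x : X) :
    (inner ℂ (Q x) (Q ((z • yosida J n) x))).re ≤ 0 := by
  rcases n.eq_zero_or_pos with rfl | hn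
  · simp [yosida]
  have hn' : (0 : ℝ) < n := by exact_mod_cast hn
  -- With `f = G_n x`, the relation `n x = n J f - f` turns the claim into that for `f`.
  have h := yosida_apply_sub hJ n x
  set f := yosida J n x with hf
  have hx : (n : ℂ) • Q x = (n : ℂ) • Q (J f) - Q f := by
    rw [← map_smul, ← map_smul, ← map_sub]
    congr 1
    linear_combination (norm := module) h
  have h1 : (n : ℂ) * inner ℂ (Q x) (Q f)
      = (n : ℂ) * inner ℂ (Q (J f)) (Q f) - ((‖Q f‖ ^ 2 : ℝ) : ℂ) := by
    have h2 : inner ℂ ((n : ℂ) • Q x) (Q f) = inner ℂ ((n : ℂ) • Q (J f) - Q f) (Q f) := by rw [hx]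
    rw [inner_sub_left, inner_smul_left, inner_smul_left, Complex.conj_natCast,
      inner_self_eq_ofReal_norm_sq] at h2
    exact h2
  have h3 : ((n : ℝ) : ℂ) * (z * inner ℂ (Q x) (Q f))
      = ((n : ℝ) : ℂ) * (z * inner ℂ (Q (J f)) (Q f)) - ((‖Q f‖ ^ 2 : ℝ) : ℂ) * z := by
    rw [Complex.ofReal_natCast]
    linear_combination z * h1
  have h4 := congrArg Complex.re h3
  rw [Complex.sub_re, Complex.re_ofReal_mul, Complex.re_ofReal_mul, Complex.re_ofReal_mul] at h4
  rw [smul_apply, map_smul, inner_smul_right]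
  have h5 := mul_nonpos_of_nonneg_of_nonpos hn'.le (hz f)
  have h6 := mul_nonneg (sq_nonneg ‖Q f‖) hz0
  by_contra! hc
  have := mul_pos hn' hc
  linarith

/-- If the inverse `J` of `B` is dissipative and `z B` is, for `z` in a cone, dissipative with
respect to the equivalent inner product `⟪Q ·, Q ·⟫`, then `B` generates a bounded holomorphic
semigroup on that cone. -/
theorem exists_semigroup_on_sectorCone {J : X →L[ℂ] X} (hJ : ∀ f, (inner ℂ (J f) f).re ≤ 0)
    (hi : Function.Injective J) (Q : X →L[ℂ] Y) {m : ℝ} (hm : 0 < m) (hQ : ∀ x, m * ‖x‖ ≤ ‖Q x‖)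
    {C : ℝ} (hC : 0 ≤ C)
    (hs : ∀ z ∈ sectorCone C, ∀ f, (z * inner ℂ (Q (J f)) (Q f)).re ≤ 0) :
    ∃ (T : ℂ → X →L[ℂ] X) (M : ℝ), T 0 = 1 ∧ (∀ z ∈ sectorCone C, ‖T z‖ ≤ M) ∧
      (∀ z ∈ sectorCone C, ∀ w ∈ sectorCone C, T (z + w) = (T z).comp (T w)) ∧
      (∀ x, ContinuousOn (fun z => T z x) (sectorCone C)) ∧
      (∀ x, DifferentiableOn ℂ (fun z => T z x) (interior (sectorCone C))) ∧
      ∀ x y, Tendsto (fun t : ℝ => ((t : ℂ)⁻¹) • (T t x - x)) (𝓝[>] 0) (𝓝 y) ↔ x = J y := by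
  have hd := denseRange_of_injective_of_dissipative hJ hi
  set M : ℝ := ‖Q‖ / m with hMdef
  have hM0 : 0 ≤ M := by positivity
  set E : ℕ → ℂ → X →L[ℂ] X := fun n z => NormedSpace.exp (z • yosida J n) with hE
  have hM (n : ℕ) (z : ℂ) (hz : z ∈ sectorCone C) (x : X) : ‖E n z x‖ ≤ M * ‖x‖ := by
    have hz0 : 0 ≤ z.re := (mul_nonneg hC (abs_nonneg _)).trans hz
    have h := norm_map_exp_apply_le (z • yosida J n) Q
      (re_mul_inner_yosida_nonpos hJ Q hz0 (hs z hz) n) x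
    rw [hMdef, div_mul_eq_mul_div, le_div_iff₀ hm, mul_comm]
    exact (hQ _).trans (h.trans (Q.le_opNorm x))
  obtain ⟨T, hT⟩ := exists_tendstoUniformlyOn_exp (commute_yosida_yosida J) hM hM0 hd (by
    rintro _ ⟨f, rfl⟩
    exact ⟨f, tendsto_yosida_apply hJ hd f⟩)
  have hTz (z : ℂ) (hz : z ∈ sectorCone C) (x : X) : Tendsto (E · z x) atTop (𝓝 (T z x)) :=
    (hT ‖z‖ x).tendsto_at ⟨hz, by simp⟩
  have hTM (z : ℂ) (hz : z ∈ sectorCone C) (x : X) : ‖T z x‖ ≤ M * ‖x‖ :=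
    le_of_tendsto (hTz z hz x).norm (Eventually.of_forall fun n => hM n z hz x)
  have hT0 : T 0 = 1 := by
    ext x
    refine tendsto_nhds_unique (hTz 0 (zero_mem_sectorCone C) x) ?_
    simp [hE]
  have hcont (x : X) : ContinuousOn (fun z => T z x) (sectorCone C) := by
    intro z hz
    have h1 : ContinuousOn (fun z => T z x) (sectorCone C ∩ Metric.closedBall 0 (‖z‖ + 1)) := by
      refine (hT (‖z‖ + 1) x).continuousOn (Frequently.of_forall fun n => Continuous.continuousOn ?_)
      exact (ContinuousLinearMap.apply ℂ X x).continuous.comp (continuous_iff_continuousAt.2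
        fun z => (hasDerivAt_exp_smul_const (𝕂 := ℂ) (yosida J n) z).continuousAt)
    refine (h1 z ⟨hz, by simp⟩).mono_of_mem_nhdsWithin (inter_mem_nhdsWithin _ ?_)
    refine Metric.closedBall_mem_nhds_of_mem ?_
    simp
  have hcomm (z : ℂ) (hz : z ∈ sectorCone C) (x : X) : T z (J x) = J (T z x) := by
    refine tendsto_nhds_unique (hTz z hz (J x)) ?_
    refine ((J.continuous.tendsto _).comp (hTz z hz x)).congr fun n => ?_
    exact DFunLike.congr_fun (((commute_yosida_left J n).smul_right z).exp_right).eq x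
  -- The generator extends `J⁻¹`.
  have hgen (f : X) : Tendsto (fun t : ℝ => ((t : ℂ)⁻¹) • (T t (J f) - J f)) (𝓝[>] 0) (𝓝 f) := by
    rw [Metric.tendsto_nhdsWithin_nhds]
    intro ε hε
    have h0 := hcont f 0 (zero_mem_sectorCone C)
    obtain ⟨δ, hδ, hδ'⟩ := Metric.continuousWithinAt_iff.1 h0 (ε / 4) (by positivity)
    refine ⟨δ, hδ, fun {t} ht htd => ?_⟩
    have ht : 0 < t := ht
    have htδ : t < δ := by simpa [abs_of_pos ht] using htd
    have hu := Metric.tendstoUniformlyOn_iff.1 (hT t f) (ε / 4) (by positivity)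
    have hbound : ∀ᶠ n in atTop, ‖E n t (J f) - J f - (t : ℂ) • f‖
        ≤ (M * ‖yosida J n (J f) - f‖ + ε / 2) * t := by
      filter_upwards [hu] with n hn
      have hder (s : ℝ) : HasDerivAt (fun s : ℝ => E n s (J f) - s • f)
          (yosida J n (E n s (J f)) - f) s :=
        ((hasDerivAt_exp_ofReal_smul_apply (yosida J n) (J f) s).sub
          ((hasDerivAt_id s).smul_const f)).congr_deriv (by simp [hE])
      have hc (s : ℝ) : yosida J n (E n s (J f)) = E n s (yosida J n (J f)) :=
        DFunLike.congr_fun (((Commute.refl (yosida J n)).smul_right (s : ℂ)).exp_right).eq (J f)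
      have := norm_image_sub_le_of_norm_deriv_le_segment' (a := 0) (b := t)
        (C := M * ‖yosida J n (J f) - f‖ + ε / 2)
        (fun s _ => (hder s).hasDerivWithinAt) (fun s hs => ?_) t ⟨ht.le, le_rfl⟩
      · have hz : E n ((0 : ℝ) : ℂ) (J f) = J f := by simp [hE]
        rw [hz, zero_smul, sub_zero, sub_zero] at this
        rw [Complex.coe_smul]
        convert this using 2
        abel
      · have hsK := ofReal_mem_sectorCone C hs.1
        have e1 := hn s ⟨hsK, by simpa [abs_of_nonneg hs.1] using hs.2.le⟩
        have e2 := hδ' hsK (by simpa [abs_of_nonneg hs.1] using hs.2.trans htδ)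
        rw [hT0, one_apply_eq_self] at e2
        have e3 : dist (E n s f) f < ε / 2 := by
          have := dist_triangle_left (E n s f) f (T s f)
          linarith
        rw [dist_eq_norm] at e3
        have e4 := hM n s hsK (yosida J n (J f) - f)
        rw [hc]
        calc ‖E n s (yosida J n (J f)) - f‖
            = ‖E n s (yosida J n (J f) - f) + (E n s f - f)‖ := by
              congr 1; rw [map_sub]; abel
          _ ≤ _ := (norm_add_le _ _).trans (add_le_add e4 e3.le)
    have hlim : ‖T t (J f) - J f - (t : ℂ) • f‖ ≤ (M * 0 + ε / 2) * t := by
      refine le_of_tendsto_of_tendsto ?_ ?_ hbound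
      · exact (((hTz t (ofReal_mem_sectorCone C ht.le) (J f)).sub_const _).sub_const _).norm
      · have := tendsto_iff_norm_sub_tendsto_zero.1 (tendsto_yosida_apply hJ hd f)
        exact ((this.const_mul M).add_const _).mul_const _
    have ht' : (t : ℂ) ≠ 0 := by exact_mod_cast ht.ne'
    have heq : (t : ℂ)⁻¹ • (T t (J f) - J f) - f
        = (t : ℂ)⁻¹ • (T t (J f) - J f - (t : ℂ) • f) := by
      rw [smul_sub _ _ ((t : ℂ) • f), inv_smul_smul₀ ht']
    rw [dist_eq_norm, heq, norm_smul, norm_inv, Complex.norm_real, Real.norm_of_nonneg ht.le,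
      inv_mul_lt_iff₀ ht]
    nlinarith
  refine ⟨T, M, hT0, fun z hz => ContinuousLinearMap.opNorm_le_bound _ hM0 (hTM z hz), ?_, hcont,
    ?_, fun x y => ⟨fun h => ?_, ?_⟩⟩
  · intro z hz w hw
    ext x
    refine tendsto_nhds_unique (hTz _ (add_mem_sectorCone hC hz hw) x) ?_
    have hadd (n : ℕ) : E n (z + w) x = E n z (E n w x) := by
      let _ : NormedAlgebra ℚ (X →L[ℂ] X) := NormedAlgebra.restrictScalars ℚ ℂ _
      simp only [hE]
      rw [add_smul, NormedSpace.exp_add_of_commute, mul_apply_eq_comp]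
      exact ((Commute.refl _).smul_left z).smul_right w
    simp only [hadd, ContinuousLinearMap.comp_apply]
    have h1 : Tendsto (fun n => E n z (E n w x - T w x)) atTop (𝓝 0) := by
      refine squeeze_zero_norm (fun n => hM n z hz _) ?_
      simpa using (tendsto_iff_norm_sub_tendsto_zero.1 (hTz w hw x)).const_mul M
    simpa using h1.add (hTz z hz (T w x))
  · intro x
    have : TendstoLocallyUniformlyOn (fun n z => E n z x) (fun z => T z x) atTop
        (interior (sectorCone C)) := by
      rw [tendstoLocallyUniformlyOn_iff_forall_isCompact isOpen_interior]
      intro K hK hKc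
      obtain ⟨R, hR⟩ := hKc.isBounded.subset_closedBall 0
      exact (hT R x).mono (Set.subset_inter (hK.trans interior_subset) hR)
    refine this.differentiableOn (Eventually.of_forall fun n => ?_) isOpen_interior
    intro z _
    exact (((ContinuousLinearMap.apply ℂ X x).hasFDerivAt.comp_hasDerivAt z
      (hasDerivAt_exp_smul_const (𝕂 := ℂ) (yosida J n) z)).differentiableAt).differentiableWithinAt
  · -- `J` commutes with `T`, so `J` maps the difference quotients of `x` to those of `J x`.
    refine tendsto_nhds_unique (hgen x) (((J.continuous.tendsto y).comp h).congr' ?_)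
    filter_upwards [self_mem_nhdsWithin] with t ht
    have ht : 0 < t := ht
    simp [hcomm t (ofReal_mem_sectorCone C ht.le)]
  · rintro rfl
    exact hgen y

end Generation

section Contraction

variable {X : Type*} [NormedAddCommGroup X] [InnerProductSpace ℂ X]

/-- A `C₀`-semigroup that is norm-differentiable for `t > 0` and whose generator is dissipative
consists of contractions, since `‖S t x‖²` has a nonpositive derivative. -/
theorem norm_le_one_of_dissipative {S : ℝ → X →L[ℂ] X} (hS : IsC0Semigroup S) {B : X →ₗ.[ℂ] X}
    (hB : IsGenerator B S) (hdiss : ∀ x y, (x, y) ∈ B.graph → (inner ℂ x y).re ≤ 0)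
    (hdiff : ∀ x, ∀ t, 0 < t → DifferentiableAt ℝ (fun s => S s x) t) (t : ℝ) (ht : 0 ≤ t) :
    ‖S t‖ ≤ 1 := by
  refine ContinuousLinearMap.opNorm_le_bound _ zero_le_one fun x => ?_
  rw [one_mul]
  rcases ht.eq_or_lt with rfl | ht
  · simp [hS.map_zero]
  have hgr (s : ℝ) (hs : 0 < s) : (S s x, deriv (fun s => S s x) s) ∈ B.graph := by
    rw [hB]
    have h := ((hdiff x s hs).hasDerivAt.tendsto_slope_zero_right)
    refine h.congr' ?_
    filter_upwards [self_mem_nhdsWithin] with r hr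
    have hr : 0 < r := hr
    rw [add_comm s r, hS.map_add r s hr.le hs.le, ← Complex.ofReal_inv, Complex.coe_smul]
    rfl
  let _ : InnerProductSpace ℝ X := InnerProductSpace.rclikeToReal ℂ X
  have ha : AntitoneOn (fun s : ℝ => ‖S s x‖ ^ 2) (Set.Ioi 0) := by
    have hd (s : ℝ) (hs : 0 < s) := (hdiff x s hs).hasDerivAt.norm_sq
    refine antitoneOn_of_hasDerivWithinAt_nonpos (convex_Ioi 0)
      (fun s hs => (hd s hs).continuousAt.continuousWithinAt)
      (fun s hs => (hd s (by simpa using hs)).hasDerivWithinAt) fun s hs => ?_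
    have := hdiss _ _ (hgr s (by simpa using hs))
    change 2 * (inner ℂ (S s x) (deriv (fun s => S s x) s)).re ≤ 0
    linarith
  have hle : ‖S t x‖ ^ 2 ≤ ‖x‖ ^ 2 := by
    refine ge_of_tendsto ((hS.tendsto_zero x).norm.pow 2) ?_
    filter_upwards [Ioo_mem_nhdsGT ht] with s hs
    exact ha hs.1 ht hs.2.le
  exact le_of_sq_le_sq hle (norm_nonneg _)

end Contraction

section GenerationShifted

theorem re_mul_nonpos_of_mem_sectorCone {C : ℝ} (hC : 0 < C) {z q : ℂ} (hz : z ∈ sectorCone C)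
    (hq : |q.im| ≤ C * -q.re) : (z * q).re ≤ 0 := by
  have hz : C * |z.im| ≤ z.re := hz
  have h1 : -(z.im * q.im) ≤ |z.im| * |q.im| := by
    rw [← abs_mul]; exact neg_le_abs _
  have h2 : |z.im| * |q.im| ≤ |z.im| * (C * -q.re) := by gcongr
  have h3 : 0 ≤ -q.re := by
    have := (abs_nonneg _).trans hq
    exact nonneg_of_mul_nonneg_right this hC
  have h4 := mul_le_mul_of_nonneg_right hz h3
  rw [Complex.mul_re]
  linarith

variable {X Y : Type*} [NormedAddCommGroup X] [InnerProductSpace ℂ X] [CompleteSpace X]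
  [NormedAddCommGroup Y] [InnerProductSpace ℂ Y]

/-- An operator `B` with a bounded inverse `J`, dissipative, and sectorial after a shift by `k` with
respect to an equivalent inner product `⟪Q ·, Q ·⟫`, generates an analytic contraction semigroup. -/
theorem exists_analytic_contraction_semigroup (B : X →ₗ.[ℂ] X) {J : X →L[ℂ] X}
    (hB : ∀ x y, (x, y) ∈ B.graph ↔ x = J y) (hJ : ∀ f, (inner ℂ (J f) f).re ≤ 0)
    (Q : X →L[ℂ] Y) {m : ℝ} (hm : 0 < m) (hQ : ∀ x, m * ‖x‖ ≤ ‖Q x‖) {k C : ℝ} (hk : 0 ≤ k)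
    (hC : 0 < C) (hs : ∀ f, |(inner ℂ (Q (J f)) (Q f)).im|
      ≤ C * (k * ‖Q (J f)‖ ^ 2 - (inner ℂ (Q (J f)) (Q f)).re)) :
    ∃ S : ℝ → X →L[ℂ] X, IsC0Semigroup S ∧ IsGenerator B S ∧ (∀ t : ℝ, 0 ≤ t → ‖S t‖ ≤ 1) ∧
      IsAnalyticSemigroup S := by
  have hi : Function.Injective J := by
    rw [injective_iff_map_eq_zero]
    intro f hf
    exact LinearPMap.graph_fst_eq_zero_snd B ((hB 0 f).2 hf.symm) rfl
  -- The inverse of `B - k`.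
  set R : X →L[ℂ] X := Ring.inverse (1 - (k : ℂ) • J) with hR
  have hu := isUnit_one_sub_smul hJ hk
  have hRf (f : X) : R f - (k : ℂ) • J (R f) = f := by
    have := DFunLike.congr_fun (Ring.mul_inverse_cancel _ hu) f
    rw [← hR] at this
    simpa using this
  have hRf' (f : X) : R (f - (k : ℂ) • J f) = f := by
    have := DFunLike.congr_fun (Ring.inverse_mul_cancel _ hu) f
    rw [← hR] at this
    simpa using this
  have hJ' (f : X) : (inner ℂ ((J * R) f) f).re ≤ 0 := by
    have h1 : inner ℂ (J (R f)) f = inner ℂ (J (R f)) (R f - (k : ℂ) • J (R f)) := by rw [hRf]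
    rw [mul_apply_eq_comp, h1, inner_sub_right, inner_smul_right, inner_self_eq_ofReal_norm_sq, Complex.sub_re,
      Complex.re_ofReal_mul, Complex.ofReal_re]
    have := hJ (R f)
    have : 0 ≤ k * ‖J (R f)‖ ^ 2 := by positivity
    linarith
  have hi' : Function.Injective (J * R) := by
    rw [injective_iff_map_eq_zero]
    intro f hf
    have : R f = 0 := hi (by simpa using hf)
    rw [← hRf f, this]
    simp
  have hs' (z : ℂ) (hz : z ∈ sectorCone C) (f : X) :
      (z * inner ℂ (Q ((J * R) f)) (Q f)).re ≤ 0 := by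
    have h1 : inner ℂ (Q (J (R f))) (Q f)
        = inner ℂ (Q (J (R f))) (Q (R f)) - ((k * ‖Q (J (R f))‖ ^ 2 : ℝ) : ℂ) := by
      have h2 : Q f = Q (R f - (k : ℂ) • J (R f)) := by rw [hRf]
      rw [h2, map_sub, map_smul, inner_sub_right, inner_smul_right, inner_self_eq_ofReal_norm_sq, Complex.ofReal_mul]
    refine re_mul_nonpos_of_mem_sectorCone hC hz ?_
    rw [mul_apply_eq_comp, h1, Complex.sub_im, Complex.sub_re, Complex.ofReal_im,
      Complex.ofReal_re, sub_zero]
    have := hs (R f)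
    convert this using 2
    ring
  obtain ⟨T, M, hT0, hTM, hTadd, hTc, hTd, hTg⟩ :=
    exists_semigroup_on_sectorCone hJ' hi' Q hm hQ hC.le hs'
  set ϑ : ℝ := Real.arctan C⁻¹ with hϑ
  have hϑ0 : 0 < ϑ := Real.arctan_pos.2 (inv_pos.2 hC)
  have hϑ1 : ϑ < Real.pi / 2 := Real.arctan_lt_pi_div_two _
  have hsub : insert 0 (openSector ϑ) ⊆ sectorCone C :=
    Set.insert_subset (zero_mem_sectorCone C) (openSector_subset_sectorCone hC)
  have hopen := isOpen_openSector hϑ1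
  set V : ℂ → X →L[ℂ] X := fun z => Complex.exp (k * z) • T z with hV
  have hVadd (z w : ℂ) (hz : z ∈ sectorCone C) (hw : w ∈ sectorCone C) :
      V (z + w) = (V z).comp (V w) := by
    simp only [hV]
    rw [hTadd z hz w hw, mul_add, Complex.exp_add, ContinuousLinearMap.smul_comp,
      ContinuousLinearMap.comp_smul, smul_smul]
  have hVc (x : X) : ContinuousOn (fun z => V z x) (sectorCone C) :=
    ContinuousOn.fun_smul (by fun_prop) (hTc x)
  have hVd : DifferentiableOn ℂ V (openSector ϑ) := by
    refine DifferentiableOn.fun_smul (by fun_prop) ?_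
    refine differentiableOn_of_forall_differentiableOn_apply hopen
      (fun z hz => hTM z (openSector_subset_sectorCone hC hz)) fun x => (hTd x).mono ?_
    exact interior_maximal (openSector_subset_sectorCone hC) hopen
  have hmem (t : ℝ) (ht : 0 < t) : (t : ℂ) ∈ openSector ϑ := by
    refine ⟨by exact_mod_cast ht.ne', ?_⟩
    rw [Complex.arg_ofReal_of_nonneg ht.le, abs_zero]
    exact hϑ0
  have hC0 : IsC0Semigroup fun t : ℝ => V t := by
    refine ⟨?_, fun s t hs ht => ?_, fun x => ?_⟩
    · simp only [hV, Complex.ofReal_zero, hT0, mul_zero, Complex.exp_zero, one_smul]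
      rfl
    · have := hVadd s t (ofReal_mem_sectorCone C hs) (ofReal_mem_sectorCone C ht)
      rw [← this, Complex.ofReal_add]
    · have h1 := hVc x 0 (zero_mem_sectorCone C)
      have h2 : Tendsto (fun t : ℝ => (t : ℂ)) (𝓝[>] 0) (𝓝[sectorCone C] 0) := by
        refine tendsto_nhdsWithin_iff.2 ⟨?_, ?_⟩
        · have := (Complex.continuous_ofReal.tendsto 0).mono_left
            (nhdsWithin_le_nhds (s := Set.Ioi (0 : ℝ)))
          simpa using this
        · filter_upwards [self_mem_nhdsWithin] with t ht
          exact ofReal_mem_sectorCone C (le_of_lt ht)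
      have := h1.tendsto.comp h2
      simpa [hV, hT0, Function.comp_def] using this
  have hgen : IsGenerator B fun t : ℝ => V t := by
    intro x y
    -- The difference quotients of `V` and of `T` at `x` differ by a term that tends to `k x`.
    have hexp : Tendsto (fun t : ℝ => (t : ℂ)⁻¹ * (Complex.exp (k * t) - 1)) (𝓝[>] 0)
        (𝓝 (k : ℂ)) := by
      have h1 : HasDerivAt (fun t : ℝ => Complex.exp (k * t)) (k : ℂ) 0 := by
        have := ((Complex.ofRealCLM.hasDerivAt (x := 0)).const_mul (k : ℂ)).cexp
        simpa using this
      have h2 := h1.tendsto_slope_zero_right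
      simpa using h2
    have hdiff (t : ℝ) : (t : ℂ)⁻¹ • (V t x - x) = Complex.exp (k * t) • ((t : ℂ)⁻¹ • (T t x - x))
        + ((t : ℂ)⁻¹ * (Complex.exp (k * t) - 1)) • x := by
      simp only [hV, smul_apply]
      module
    have hone (r : ℝ) : Tendsto (fun t : ℝ => Complex.exp (r * t)) (𝓝[>] 0) (𝓝 1) := by
      have : Continuous fun t : ℝ => Complex.exp (r * t) := by fun_prop
      simpa using (this.tendsto 0).mono_left nhdsWithin_le_nhds
    have hiff : Tendsto (fun t : ℝ => (t : ℂ)⁻¹ • (V t x - x)) (𝓝[>] 0) (𝓝 y) ↔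
        Tendsto (fun t : ℝ => (t : ℂ)⁻¹ • (T t x - x)) (𝓝[>] 0) (𝓝 (y - (k : ℂ) • x)) := by
      constructor
      · intro h
        have := (hone (-k)).smul (h.sub (hexp.smul_const x))
        rw [one_smul] at this
        refine this.congr fun t => ?_
        rw [hdiff, add_sub_cancel_right, smul_smul, ← Complex.exp_add]
        simp
      · intro h
        have := ((hone k).smul h).add (hexp.smul_const x)
        rw [one_smul, sub_add_cancel] at this
        exact this.congr fun t => (hdiff t).symm
    rw [hiff, hTg, hB, mul_apply_eq_comp]
    constructor
    · intro h
      have : y - (k : ℂ) • x = y - (k : ℂ) • J y := by rw [← h]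
      rw [this, hRf', h]
    · intro h
      have h1 := hRf (y - (k : ℂ) • x)
      rw [← h] at h1
      rw [h]
      congr 1
      linear_combination (norm := module) h1
  refine ⟨fun t => V t, hC0, hgen, ?_, ϑ, hϑ0, hϑ1, V, fun _ _ => rfl,
    fun z hz w hw => hVadd z w (hsub hz) (hsub hw), fun x => (hVc x).mono hsub, hVd⟩
  refine norm_le_one_of_dissipative hC0 hgen (fun x y hxy => ?_) fun x t ht => ?_
  · rw [(hB x y).1 hxy]
    exact hJ y
  · have h1 := (hVd.differentiableAt (hopen.mem_nhds (hmem t ht))).hasDerivAt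
    have h2 := (ContinuousLinearMap.apply ℂ X x).hasFDerivAt.comp_hasDerivAt (t : ℂ) h1
    exact (HasDerivAt.scomp t h2 Complex.ofRealCLM.hasDerivAt).differentiableAt

end GenerationShifted

/-! ### The quadratic form of the high-frequency regime -/

section SectorialForm

variable {H : Type*} [NormedAddCommGroup H] [InnerProductSpace ℂ H]

theorem norm_ofReal_mul_inner_le (r : ℝ) (x y : H) :
    ‖(r : ℂ) * inner ℂ x y‖ ≤ |r| * (‖x‖ * ‖y‖) := by
  rw [norm_mul, Complex.norm_real, Real.norm_eq_abs]
  exact mul_le_mul_of_nonneg_left (norm_inner_le_norm x y) (abs_nonneg r)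

/-- In the energy inner product the form of the system has real part `-g ‖q‖² - ‖t‖²`. -/
theorem re_energyForm_nonpos (a : ℝ) {g : ℝ} (hg : 0 ≤ g) (η : ℝ) (p q y t : H) :
    ((g : ℂ) * inner ℂ q (y - q) + ((a ^ 2 : ℝ) : ℂ) * inner ℂ p y
      + inner ℂ y (-((a ^ 2 : ℝ) : ℂ) • p - (g : ℂ) • q + (η : ℂ) • t)
      + inner ℂ t (-(η : ℂ) • y - t)).re ≤ 0 := by
  have h (x z : H) : (inner ℂ x z : ℂ).re = (inner ℂ z x : ℂ).re := by
    rw [← inner_conj_symm, Complex.conj_re]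
  simp only [inner_sub_right, inner_add_right, inner_smul_right, ← Complex.ofReal_neg,
    Complex.add_re, Complex.sub_re, Complex.re_ofReal_mul, inner_self_eq_ofReal_norm_sq,
    Complex.ofReal_re]
  rw [h y p, h y q, h y t]
  have := mul_nonneg hg (sq_nonneg ‖q‖)
  nlinarith [sq_nonneg ‖t‖]

/-- Young's inequality for the product of two sums. -/
theorem mul_add_mul_add_le_young {K δ : ℝ} (hδ : 0 < δ) (P Q Y T : ℝ) :
    K * ((P + Q) * (Y + T)) ≤ δ / 2 * (Y ^ 2 + T ^ 2) + 2 * K ^ 2 / δ * (P ^ 2 + Q ^ 2) := by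
  have h : δ / 2 * (Y ^ 2 + T ^ 2) + 2 * K ^ 2 / δ * (P ^ 2 + Q ^ 2)
      - K * ((P + Q) * (Y + T)) = (δ / 2 * (Y + T) - K * (P + Q)) ^ 2 / δ
        + δ / 4 * (Y - T) ^ 2 + K ^ 2 / δ * (P - Q) ^ 2 := by
    field_simp
    ring
  have : 0 ≤ (δ / 2 * (Y + T) - K * (P + Q)) ^ 2 / δ + δ / 4 * (Y - T) ^ 2
      + K ^ 2 / δ * (P - Q) ^ 2 := by positivity
  linarith

/-- With `κ = η / (1 + η²)` the left-hand side is
`-(η² Y² + T² - |η| Y T) / (1 + η²)`, and `η² Y² + T² - |η| Y T` is at least half of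
`η² Y² + T²`. -/
theorem coercive_cross_term (η Y T : ℝ) :
    -(η / (1 + η ^ 2) * η) * Y ^ 2 - (1 - η / (1 + η ^ 2) * η) * T ^ 2
      + |η / (1 + η ^ 2)| * (Y * T) ≤ -(min (η ^ 2) 1 / (2 * (1 + η ^ 2))) * (Y ^ 2 + T ^ 2) := by
  have hN : 0 < 1 + η ^ 2 := by positivity
  have e4 : -(η / (1 + η ^ 2) * η) * Y ^ 2 - (1 - η / (1 + η ^ 2) * η) * T ^ 2
      + |η / (1 + η ^ 2)| * (Y * T)
      = -(2 * (η ^ 2 * Y ^ 2 + T ^ 2 - |η| * Y * T)) / (2 * (1 + η ^ 2)) := by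
    rw [abs_div, abs_of_pos hN]; field_simp; ring
  have e5 : -(min (η ^ 2) 1 / (2 * (1 + η ^ 2))) * (Y ^ 2 + T ^ 2)
      = -(min (η ^ 2) 1 * (Y ^ 2 + T ^ 2)) / (2 * (1 + η ^ 2)) := by ring
  rw [e4, e5]
  refine div_le_div_of_nonneg_right (neg_le_neg ?_) (by positivity)
  have m1 := mul_le_mul_of_nonneg_right (min_le_left (η ^ 2) 1) (sq_nonneg Y)
  have m2 := mul_le_mul_of_nonneg_right (min_le_right (η ^ 2) 1) (sq_nonneg T)
  have m3 := sq_nonneg (|η| * Y - T)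
  have m5 : (|η| * Y - T) ^ 2 = η ^ 2 * Y ^ 2 + T ^ 2 - 2 * (|η| * Y * T) := by
    rw [← sq_abs η]; ring
  linarith

/-- Adding the cross term `κ (⟪r, θ⟫ + ⟪θ, r⟫)`, with `κ = η / (1 + η²)`, to the energy makes the form
coercive in `y` and `t`, which carry the unbounded part of the operator. The variables `p` and `q`
contribute terms of lower order, whatever their weights. -/
theorem exists_sectorial_bound {a b g η κ : ℝ} (hη : η ≠ 0)
    (hκ : κ = η / (1 + η ^ 2)) :
    ∃ k C : ℝ, 0 ≤ k ∧ 0 < C ∧ ∀ (p q y t ρ τ : H) (z : ℂ),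
      ρ = -((a ^ 2 : ℝ) : ℂ) • p - (g : ℂ) • q + (η : ℂ) • t → τ = -(η : ℂ) • y - t →
      z = inner ℂ p y + (b : ℂ) * inner ℂ q (y - q) + inner ℂ y ρ + (κ : ℂ) * inner ℂ y τ
        + (κ : ℂ) * inner ℂ t ρ + inner ℂ t τ →
      |z.im| ≤ C * (k * (‖p‖ ^ 2 + ‖q‖ ^ 2) - z.re) := by
  have hη2 : 0 < η ^ 2 := by positivity
  set δ : ℝ := min (η ^ 2) 1 / (2 * (1 + η ^ 2)) with hδ
  have hδ0 : 0 < δ := by positivity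
  set K : ℝ := 1 + a ^ 2 + |b| + |g| + |κ * a ^ 2| + |κ * g| with hK
  have hK0 : 0 < K := by positivity
  set D : ℝ := 2 * |η| + |κ| + 2 * K + 1 with hD
  have hD0 : 0 < D := by positivity
  refine ⟨K + 2 * K ^ 2 / δ + δ / 2, 2 * D / δ, by positivity, by positivity, ?_⟩
  rintro p q y t ρ τ z rfl rfl hz
  -- The decomposition of the form: skew part, coercive part, cross terms.
  set z0 : ℂ := (η : ℂ) * inner ℂ y t - (η : ℂ) * inner ℂ t y with hz0
  set z2 : ℂ := (1 : ℝ) * inner ℂ p y - ((a ^ 2 : ℝ) : ℂ) * inner ℂ y p + (b : ℂ) * inner ℂ q y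
    - (g : ℂ) * inner ℂ y q - ((κ * a ^ 2 : ℝ) : ℂ) * inner ℂ t p
    - ((κ * g : ℝ) : ℂ) * inner ℂ t q - (b : ℂ) * inner ℂ q q with hz2
  have hdec : z = z0 + (((-(κ * η) * ‖y‖ ^ 2 - (1 - κ * η) * ‖t‖ ^ 2 : ℝ) : ℂ)
      - (κ : ℂ) * inner ℂ y t) + z2 := by
    rw [hz, hz0, hz2]
    simp only [inner_sub_right, inner_add_right, inner_smul_right]
    rw [inner_self_eq_ofReal_norm_sq y, inner_self_eq_ofReal_norm_sq t]
    push_cast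
    ring
  have hz0re : z0.re = 0 := by
    rw [hz0, Complex.sub_re, Complex.re_ofReal_mul, Complex.re_ofReal_mul,
      ← inner_conj_symm t y, Complex.conj_re, sub_self]
  have hyt : ‖(κ : ℂ) * inner ℂ y t‖ ≤ |κ| * (‖y‖ * ‖t‖) := norm_ofReal_mul_inner_le _ _ _
  have hz0n : ‖z0‖ ≤ 2 * |η| * (‖y‖ * ‖t‖) := by
    refine (norm_sub_le_of_le (norm_ofReal_mul_inner_le η y t)
      (norm_ofReal_mul_inner_le η t y)).trans (le_of_eq (by ring))
  have hp := norm_nonneg p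
  have hq := norm_nonneg q
  have hy := norm_nonneg y
  have ht := norm_nonneg t
  have hz2n : ‖z2‖ ≤ K * ((‖p‖ + ‖q‖) * (‖y‖ + ‖t‖)) + K * ‖q‖ ^ 2 := by
    refine (norm_sub_le_of_le (norm_sub_le_of_le (norm_sub_le_of_le (norm_sub_le_of_le
      (norm_add_le_of_le (norm_sub_le_of_le (norm_ofReal_mul_inner_le 1 p y)
      (norm_ofReal_mul_inner_le _ y p)) (norm_ofReal_mul_inner_le b q y))
      (norm_ofReal_mul_inner_le g y q)) (norm_ofReal_mul_inner_le _ t p))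
      (norm_ofReal_mul_inner_le _ t q)) (norm_ofReal_mul_inner_le b q q)).trans ?_
    rw [abs_one, abs_of_nonneg (sq_nonneg a)]
    have e1 : 1 + a ^ 2 ≤ K := by
      rw [hK]
      linarith only [abs_nonneg b, abs_nonneg g, abs_nonneg (κ * a ^ 2), abs_nonneg (κ * g)]
    have e2 : |b| + |g| ≤ K := by
      rw [hK]
      linarith only [sq_nonneg a, abs_nonneg (κ * a ^ 2), abs_nonneg (κ * g)]
    have e3 : |κ * a ^ 2| ≤ K := by
      rw [hK]
      linarith only [sq_nonneg a, abs_nonneg b, abs_nonneg g, abs_nonneg (κ * g)]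
    have e4 : |κ * g| ≤ K := by
      rw [hK]
      linarith only [sq_nonneg a, abs_nonneg b, abs_nonneg g, abs_nonneg (κ * a ^ 2)]
    have e5 : |b| ≤ K := by linarith only [abs_nonneg g, e2]
    have m1 := mul_le_mul_of_nonneg_right e1 (mul_nonneg hp hy)
    have m2 := mul_le_mul_of_nonneg_right e2 (mul_nonneg hq hy)
    have m3 := mul_le_mul_of_nonneg_right e3 (mul_nonneg ht hp)
    have m4 := mul_le_mul_of_nonneg_right e4 (mul_nonneg ht hq)
    have m5 := mul_le_mul_of_nonneg_right e5 (mul_nonneg hq hq)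
    linarith only [m1, m2, m3, m4, m5]
  have hV : (‖p‖ + ‖q‖) * (‖y‖ + ‖t‖) ≤ ‖p‖ ^ 2 + ‖q‖ ^ 2 + (‖y‖ ^ 2 + ‖t‖ ^ 2) := by
    nlinarith only [sq_nonneg (‖p‖ - ‖y‖), sq_nonneg (‖p‖ - ‖t‖), sq_nonneg (‖q‖ - ‖y‖),
      sq_nonneg (‖q‖ - ‖t‖)]
  have hY := mul_add_mul_add_le_young (K := K) hδ0 ‖p‖ ‖q‖ ‖y‖ ‖t‖
  have hcoer := coercive_cross_term η ‖y‖ ‖t‖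
  rw [← hκ, ← hδ] at hcoer
  clear_value z0 z2 δ K D
  have hre : z.re ≤ -(δ / 2) * (‖y‖ ^ 2 + ‖t‖ ^ 2)
      + (K + 2 * K ^ 2 / δ) * (‖p‖ ^ 2 + ‖q‖ ^ 2) := by
    have e1 := Complex.abs_re_le_norm ((κ : ℂ) * inner ℂ y t)
    have e2 := neg_abs_le ((κ : ℂ) * inner ℂ y t).re
    have e3 := Complex.re_le_norm z2
    have e4 := mul_nonneg hK0.le (sq_nonneg ‖p‖)
    rw [hdec, Complex.add_re, Complex.add_re, Complex.sub_re, hz0re, Complex.ofReal_re]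
    linarith only [e1, e2, e3, e4, hY, hcoer, hz2n, hyt]
  have him : |z.im| ≤ D * (‖p‖ ^ 2 + ‖q‖ ^ 2 + (‖y‖ ^ 2 + ‖t‖ ^ 2)) := by
    have e1 : |z.im| ≤ ‖z0‖ + ‖(κ : ℂ) * inner ℂ y t‖ + ‖z2‖ := by
      have : z.im = z0.im - ((κ : ℂ) * inner ℂ y t).im + z2.im := by
        rw [hdec, Complex.add_im, Complex.add_im, Complex.sub_im, Complex.ofReal_im]
        ring
      rw [this]
      exact (abs_add_le _ _).trans (add_le_add ((abs_sub _ _).trans (add_le_add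
        (Complex.abs_im_le_norm _) (Complex.abs_im_le_norm _))) (Complex.abs_im_le_norm _))
    have e2 : ‖y‖ * ‖t‖ ≤ ‖p‖ ^ 2 + ‖q‖ ^ 2 + (‖y‖ ^ 2 + ‖t‖ ^ 2) := by
      nlinarith only [sq_nonneg (‖y‖ - ‖t‖), sq_nonneg ‖p‖, sq_nonneg ‖q‖, sq_nonneg ‖y‖,
        sq_nonneg ‖t‖]
    have e3 : ‖q‖ ^ 2 ≤ ‖p‖ ^ 2 + ‖q‖ ^ 2 + (‖y‖ ^ 2 + ‖t‖ ^ 2) := by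
      nlinarith only [sq_nonneg ‖p‖, sq_nonneg ‖y‖, sq_nonneg ‖t‖]
    have m1 := mul_le_mul_of_nonneg_left e2 (show 0 ≤ 2 * |η| by positivity)
    have m2 := mul_le_mul_of_nonneg_left e2 (abs_nonneg κ)
    have m3 := mul_le_mul_of_nonneg_left e3 hK0.le
    have m4 := mul_le_mul_of_nonneg_left hV hK0.le
    have m5 : 0 ≤ ‖p‖ ^ 2 + ‖q‖ ^ 2 + (‖y‖ ^ 2 + ‖t‖ ^ 2) := by positivity
    rw [hD]
    linarith only [e1, m1, m2, m3, m4, m5, hz0n, hyt, hz2n]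
  calc |z.im| ≤ D * (‖p‖ ^ 2 + ‖q‖ ^ 2 + (‖y‖ ^ 2 + ‖t‖ ^ 2)) := him
    _ = 2 * D / δ * (δ / 2 * (‖p‖ ^ 2 + ‖q‖ ^ 2 + (‖y‖ ^ 2 + ‖t‖ ^ 2))) := by field_simp
    _ ≤ _ := mul_le_mul_of_nonneg_left (by linarith only [hre]) (by positivity)

end SectorialForm

/-! ### The square root of `A` -/

namespace StrictlyPositiveOperator

variable {H : Type*} [NormedAddCommGroup H] [InnerProductSpace ℂ H] [CompleteSpace H]
  (A : StrictlyPositiveOperator H)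

theorem negPow_zero : A.negPow 0 = 1 := CFC.rpow_zero _ A.inv_nonneg

theorem negPow_half_mul_self : A.negPow (1 / 2) * A.negPow (1 / 2) = A.inv := by
  unfold negPow
  rw [← CFC.sqrt_eq_rpow]
  exact CFC.sqrt_mul_sqrt_self _ A.inv_nonneg

theorem negPow_half_apply_apply (x : H) : A.negPow (1 / 2) (A.negPow (1 / 2) x) = A.inv x :=
  DFunLike.congr_fun A.negPow_half_mul_self x

theorem inner_negPow_half (x y : H) :
    inner ℂ (A.negPow (1 / 2) x) y = inner ℂ x (A.negPow (1 / 2) y) := by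
  have h : 0 ≤ A.negPow (1 / 2) := CFC.rpow_nonneg
  rw [ContinuousLinearMap.nonneg_iff_isPositive] at h
  exact h.isSymmetric x y

theorem mem_halfDomain (x : H) : x ∈ A.halfDomain ↔ ∃ y, A.negPow (1 / 2) y = x := by
  unfold halfDomain posPow
  rw [LinearPMap.inverse_domain]
  constructor
  · rintro ⟨y, hy⟩
    exact ⟨y, hy⟩
  · rintro ⟨y, hy⟩
    exact ⟨⟨y, trivial⟩, hy⟩

theorem negPow_half_mem (y : H) : A.negPow (1 / 2) y ∈ A.halfDomain :=
  (A.mem_halfDomain _).2 ⟨y, rfl⟩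

theorem half_negPow_half (y : H) (hy : A.negPow (1 / 2) y ∈ A.halfDomain) :
    A.half ⟨A.negPow (1 / 2) y, hy⟩ = y := by
  have hker : ((A.negPow (1 / 2)).toLinearMap.toPMap ⊤).toFun.ker = ⊥ := by
    rw [LinearMap.ker_eq_bot']
    intro m hm
    apply Subtype.ext
    apply A.negPow_half_injective
    rw [Submodule.coe_zero, map_zero]
    exact hm
  exact LinearPMap.inverse_apply_eq hker (y := ⟨_, hy⟩) (x := ⟨y, trivial⟩) rfl

theorem negPow_half_half (x : A.halfDomain) : A.negPow (1 / 2) (A.half x) = x := by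
  obtain ⟨x, hx⟩ := x
  obtain ⟨y, rfl⟩ := (A.mem_halfDomain x).1 hx
  rw [A.half_negPow_half]

/-- The square root of `A`, as a bijection of its domain onto `H`. -/
noncomputable def halfEquiv : A.halfDomain ≃ₗ[ℂ] H :=
  { A.half with
    invFun := fun y => ⟨A.negPow (1 / 2) y, A.negPow_half_mem y⟩
    left_inv := fun x => Subtype.ext (A.negPow_half_half x)
    right_inv := fun y => A.half_negPow_half y _ }

/-- `A x = y` if and only if `x = A⁻¹ y`. -/
theorem exists_apply_eq_iff (x y : H) :
    (∃ hx : x ∈ A.toLinearPMap.domain, A.toLinearPMap ⟨x, hx⟩ = y) ↔ x = A.inv y := by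
  constructor
  · rintro ⟨hx, rfl⟩
    exact (A.inv_apply ⟨x, hx⟩).symm
  · rintro rfl
    exact ⟨A.inv_mem y, A.apply_inv y⟩

end StrictlyPositiveOperator

/-! ### Energy coordinates on the phase space -/

namespace MGTFourier

open PhaseSpace

/-- The Hilbert space `H⁴` of the coordinates `(A^½(u + αv), A^½ v, v + αw, θ)`. -/
abbrev Coords (H : Type*) : Type _ := PiLp 2 fun _ : Fin 4 => H

theorem Coords.norm_sq {H : Type*} [NormedAddCommGroup H] (x : Coords H) :
    ‖x‖ ^ 2 = ‖x 0‖ ^ 2 + ‖x 1‖ ^ 2 + ‖x 2‖ ^ 2 + ‖x 3‖ ^ 2 := by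
  rw [PiLp.norm_sq_eq_of_L2, Fin.sum_univ_four]

theorem Coords.inner_eq {H : Type*} [NormedAddCommGroup H] [InnerProductSpace ℂ H]
    (x y : Coords H) : inner ℂ x y
    = inner ℂ (x 0) (y 0) + inner ℂ (x 1) (y 1) + inner ℂ (x 2) (y 2) + inner ℂ (x 3) (y 3) := by
  rw [PiLp.inner_apply, Fin.sum_univ_four]

section Shear

variable {H : Type*} [NormedAddCommGroup H] [InnerProductSpace ℂ H]

/-- The map `(p, q, r, θ) ↦ (p, q, r + κθ, γθ)`. For `κ² + γ² = 1` it pulls the inner product of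
`H⁴` back to one that differs from it by the cross term `κ (⟪r, θ⟫ + ⟪θ, r⟫)`. -/
noncomputable def shearCoords (H : Type*) [NormedAddCommGroup H] [InnerProductSpace ℂ H]
    (κ γ : ℝ) : Coords H →L[ℂ] Coords H :=
  let π := fun i => PiLp.proj (𝕜 := ℂ) 2 (fun _ : Fin 4 => H) i
  (PiLp.continuousLinearEquiv 2 ℂ (fun _ : Fin 4 => H)).symm.toContinuousLinearMap ∘L
    ContinuousLinearMap.pi ![π 0, π 1, π 2 + (κ : ℂ) • π 3, (γ : ℂ) • π 3]

theorem norm_sq_shearCoords (κ γ : ℝ) (x : Coords H) : ‖shearCoords H κ γ x‖ ^ 2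
    = ‖x 0‖ ^ 2 + ‖x 1‖ ^ 2 + ‖x 2 + (κ : ℂ) • x 3‖ ^ 2 + γ ^ 2 * ‖x 3‖ ^ 2 := by
  rw [Coords.norm_sq]
  change _ + _ + _ + ‖(γ : ℂ) • x 3‖ ^ 2 = _
  rw [norm_smul, Complex.norm_real, mul_pow, Real.norm_eq_abs, sq_abs]
  rfl

theorem inner_shearCoords {κ γ : ℝ} (h : κ ^ 2 + γ ^ 2 = 1) (x y : Coords H) :
    inner ℂ (shearCoords H κ γ x) (shearCoords H κ γ y)
      = inner ℂ (x 0) (y 0) + inner ℂ (x 1) (y 1) + inner ℂ (x 2) (y 2)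
        + (κ : ℂ) * inner ℂ (x 3) (y 2) + (κ : ℂ) * inner ℂ (x 2) (y 3) + inner ℂ (x 3) (y 3) := by
  rw [Coords.inner_eq]
  change inner ℂ (x 0) (y 0) + inner ℂ (x 1) (y 1)
    + inner ℂ (x 2 + (κ : ℂ) • x 3) (y 2 + (κ : ℂ) • y 3)
    + inner ℂ ((γ : ℂ) • x 3) ((γ : ℂ) • y 3) = _
  simp only [inner_add_left, inner_add_right, inner_smul_left, inner_smul_right,
    Complex.conj_ofReal]
  have h' : (κ : ℂ) ^ 2 + (γ : ℂ) ^ 2 = 1 := by exact_mod_cast h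
  linear_combination inner ℂ (x 3) (y 3) * h'

/-- For `|κ| ≤ 1/2` the sheared norm is equivalent to the norm of `H⁴`. -/
theorem norm_le_two_mul_norm_shearCoords {κ γ : ℝ} (h : κ ^ 2 + γ ^ 2 = 1) (hκ : |κ| ≤ 1 / 2)
    (x : Coords H) : ‖x‖ ≤ 2 * ‖shearCoords H κ γ x‖ := by
  refine le_of_sq_le_sq ?_ (by positivity)
  rw [mul_pow, norm_sq_shearCoords, Coords.norm_sq]
  have h1 : ‖x 2‖ ≤ ‖x 2 + (κ : ℂ) • x 3‖ + 1 / 2 * ‖x 3‖ := by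
    have h2 : ‖(κ : ℂ) • x 3‖ ≤ 1 / 2 * ‖x 3‖ := by
      rw [norm_smul, Complex.norm_real, Real.norm_eq_abs]
      gcongr
    calc ‖x 2‖ = ‖x 2 + (κ : ℂ) • x 3 - (κ : ℂ) • x 3‖ := by rw [add_sub_cancel_right]
      _ ≤ _ := (norm_sub_le _ _).trans (by linarith)
  have h3 : κ ^ 2 ≤ 1 / 4 := by
    rw [← sq_abs]
    nlinarith only [hκ, abs_nonneg κ]
  have h4 : 3 / 4 ≤ γ ^ 2 := by linarith
  have h5 := mul_le_mul_of_nonneg_right h4 (sq_nonneg ‖x 3‖)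
  have h6 : ‖x 2‖ ^ 2 ≤ 2 * ‖x 2 + (κ : ℂ) • x 3‖ ^ 2 + 1 / 2 * ‖x 3‖ ^ 2 := by
    nlinarith only [h1, norm_nonneg (x 2), sq_nonneg (‖x 2 + (κ : ℂ) • x 3‖ - 1 / 2 * ‖x 3‖)]
  nlinarith only [h5, h6, sq_nonneg ‖x 0‖, sq_nonneg ‖x 1‖, sq_nonneg ‖x 3‖,
    sq_nonneg ‖x 2 + (κ : ℂ) • x 3‖]

end Shear

variable {H : Type*} [NormedAddCommGroup H] [InnerProductSpace ℂ H] [CompleteSpace H]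
  {A : StrictlyPositiveOperator H} {c : MGTFourierCoeffs}

/-- The map `U ↦ (A^½(u + αv), A^½ v, v + αw, θ)`, as a linear bijection. -/
noncomputable def coordsₗ : PhaseSpace A c ≃ₗ[ℂ] Coords H where
  toFun U := !₂[A.half (u U) + (c.α : ℂ) • A.half (v U), A.half (v U),
    (v U : H) + (c.α : ℂ) • w U, θ U]
  map_add' U V := by
    ext i
    fin_cases i <;> simp only [map_add, PiLp.add_apply] <;> simp <;> module
  map_smul' r U := by
    ext i
    fin_cases i <;> simp only [map_smul, PiLp.smul_apply] <;> simp <;> module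
  invFun x := PhaseSpace.mk (A.halfEquiv.symm (x 0 - (c.α : ℂ) • x 1)) (A.halfEquiv.symm (x 1))
    ((c.α : ℂ)⁻¹ • (x 2 - A.negPow (1 / 2) (x 1))) (x 3)
  left_inv U := by
    have hα : (c.α : ℂ) ≠ 0 := by exact_mod_cast c.α_pos.ne'
    refine PhaseSpace.ext ?_ ?_ ?_ ?_
    · change A.halfEquiv.symm ((A.half (u U) + (c.α : ℂ) • A.half (v U))
        - (c.α : ℂ) • A.half (v U)) = u U
      rw [add_sub_cancel_right]
      exact A.halfEquiv.symm_apply_apply _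
    · exact A.halfEquiv.symm_apply_apply _
    · change (c.α : ℂ)⁻¹ • ((v U : H) + (c.α : ℂ) • w U - A.negPow (1 / 2) (A.half (v U))) = w U
      rw [A.negPow_half_half, add_sub_cancel_left, inv_smul_smul₀ hα]
    · rfl
  right_inv x := by
    have hα : (c.α : ℂ) ≠ 0 := by exact_mod_cast c.α_pos.ne'
    have h (y : H) : A.half (A.halfEquiv.symm y) = y := A.halfEquiv.apply_symm_apply y
    ext i
    fin_cases i
    · change A.half (A.halfEquiv.symm (x 0 - (c.α : ℂ) • x 1))
        + (c.α : ℂ) • A.half (A.halfEquiv.symm (x 1)) = x 0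
      rw [h, h, sub_add_cancel]
    · exact h (x 1)
    · change A.negPow (1 / 2) (x 1)
        + (c.α : ℂ) • (c.α : ℂ)⁻¹ • (x 2 - A.negPow (1 / 2) (x 1)) = x 2
      rw [smul_inv_smul₀ hα, add_sub_cancel]
    · rfl

theorem coordsₗ_zero (U : PhaseSpace A c) :
    coordsₗ U 0 = A.half (u U) + (c.α : ℂ) • A.half (v U) := rfl

theorem coordsₗ_one (U : PhaseSpace A c) : coordsₗ U 1 = A.half (v U) := rfl

theorem coordsₗ_two (U : PhaseSpace A c) : coordsₗ U 2 = (v U : H) + (c.α : ℂ) • w U := rfl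

theorem coordsₗ_three (U : PhaseSpace A c) : coordsₗ U 3 = θ U := rfl

theorem inner_eq_coords (U V : PhaseSpace A c) : inner ℂ U V
    = ((c.a ^ 2 * c.α * (c.β - c.α) : ℝ) : ℂ) * inner ℂ (coordsₗ U 1) (coordsₗ V 1)
      + ((c.a ^ 2 : ℝ) : ℂ) * inner ℂ (coordsₗ U 0) (coordsₗ V 0)
      + inner ℂ (coordsₗ U 2) (coordsₗ V 2) + inner ℂ (coordsₗ U 3) (coordsₗ V 3) := rfl

theorem norm_sq_eq_coords (U : PhaseSpace A c) : ‖U‖ ^ 2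
    = c.a ^ 2 * c.α * (c.β - c.α) * ‖coordsₗ U 1‖ ^ 2 + c.a ^ 2 * ‖coordsₗ U 0‖ ^ 2
      + ‖coordsₗ U 2‖ ^ 2 + ‖coordsₗ U 3‖ ^ 2 := by
  have h := inner_eq_coords U U
  simp only [inner_self_eq_ofReal_norm_sq] at h
  exact_mod_cast h

theorem exists_norm_coordsₗ_le : ∃ K : ℝ, 0 < K ∧ ∀ U : PhaseSpace A c,
    ‖coordsₗ U‖ ≤ K * ‖U‖ ∧ ‖U‖ ≤ K * ‖coordsₗ U‖ := by
  have h1 : 0 < c.a ^ 2 := by have := c.a_ne_zero; positivity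
  have h2 : 0 < c.a ^ 2 * c.α * (c.β - c.α) :=
    mul_pos (mul_pos h1 c.α_pos) (sub_pos.2 c.α_lt_β)
  set g := c.a ^ 2 * c.α * (c.β - c.α) with hg
  set K := 1 + c.a ^ 2 + g + (c.a ^ 2)⁻¹ + g⁻¹ with hK
  have i1 : 0 < (c.a ^ 2)⁻¹ := inv_pos.2 h1
  have i2 : 0 < g⁻¹ := inv_pos.2 h2
  have hK1 : 1 ≤ K := by rw [hK]; linarith only [h1, h2, i1, i2]
  have hK2 : c.a ^ 2 ≤ K := by rw [hK]; linarith only [h2, i1, i2]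
  have hK3 : g ≤ K := by rw [hK]; linarith only [h1, i1, i2]
  have hK4 : 1 ≤ K * c.a ^ 2 := by
    rw [← inv_mul_cancel₀ h1.ne']
    exact mul_le_mul_of_nonneg_right (by rw [hK]; linarith only [h1, h2, i2]) h1.le
  have hK5 : 1 ≤ K * g := by
    rw [← inv_mul_cancel₀ h2.ne']
    exact mul_le_mul_of_nonneg_right (by rw [hK]; linarith only [h1, h2, i1]) h2.le
  clear_value K g
  have hK0 : 0 < K := by linarith
  have hKK : K ≤ K ^ 2 := by nlinarith only [hK1]
  refine ⟨K, hK0, fun U => ⟨?_, ?_⟩⟩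
  · refine le_of_sq_le_sq ?_ (by positivity)
    rw [mul_pow]
    refine le_trans ?_ (mul_le_mul_of_nonneg_right hKK (sq_nonneg _))
    rw [Coords.norm_sq, norm_sq_eq_coords, ← hg]
    have m0 := mul_le_mul_of_nonneg_right hK4 (sq_nonneg ‖coordsₗ U 0‖)
    have m1 := mul_le_mul_of_nonneg_right hK5 (sq_nonneg ‖coordsₗ U 1‖)
    have m2 := mul_le_mul_of_nonneg_right hK1 (sq_nonneg ‖coordsₗ U 2‖)
    have m3 := mul_le_mul_of_nonneg_right hK1 (sq_nonneg ‖coordsₗ U 3‖)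
    linarith only [m0, m1, m2, m3]
  · refine le_of_sq_le_sq ?_ (by positivity)
    rw [mul_pow]
    refine le_trans ?_ (mul_le_mul_of_nonneg_right hKK (sq_nonneg _))
    rw [Coords.norm_sq, norm_sq_eq_coords, ← hg]
    have m0 := mul_le_mul_of_nonneg_right hK2 (sq_nonneg ‖coordsₗ U 0‖)
    have m1 := mul_le_mul_of_nonneg_right hK3 (sq_nonneg ‖coordsₗ U 1‖)
    have m2 := mul_le_mul_of_nonneg_right hK1 (sq_nonneg ‖coordsₗ U 2‖)
    have m3 := mul_le_mul_of_nonneg_right hK1 (sq_nonneg ‖coordsₗ U 3‖)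
    linarith only [m0, m1, m2, m3]

/-- The energy coordinates as an isomorphism of Hilbert spaces (which is not isometric: the energy
weights the first two coordinates). -/
noncomputable def coords : PhaseSpace A c ≃L[ℂ] Coords H where
  toLinearEquiv := coordsₗ
  continuous_toFun := by
    obtain ⟨K, _, hK⟩ := exists_norm_coordsₗ_le (A := A) (c := c)
    exact AddMonoidHomClass.continuous_of_bound (coordsₗ (A := A) (c := c)).toLinearMap K
      fun U => (hK U).1
  continuous_invFun := by
    obtain ⟨K, _, hK⟩ := exists_norm_coordsₗ_le (A := A) (c := c)
    refine AddMonoidHomClass.continuous_of_bound (coordsₗ (A := A) (c := c)).symm.toLinearMap K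
      fun x => ?_
    have := (hK (coordsₗ.symm x)).2
    rwa [LinearEquiv.apply_symm_apply] at this

instance instCompleteSpacePhaseSpace : CompleteSpace (PhaseSpace A c) :=
  (completeSpace_congr (e := (coords (A := A) (c := c)).toEquiv) (coords (A := A) (c := c)).isUniformEmbedding).2 inferInstance

end MGTFourier

/-! ### The bounded inverse of the operator -/

namespace MGTFourier

open PhaseSpace

variable {H : Type*} [NormedAddCommGroup H] [InnerProductSpace ℂ H] [CompleteSpace H]
  (A : StrictlyPositiveOperator H) (c : MGTFourierCoeffs)

/-- The inverse of `opB A c 1` in energy coordinates: it sends `(P, Q, R, T)` to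
`(p, P - αQ, A^(-½)P, -ηA^(-½)P - A⁻¹T)`, where
`a²p = -(A^(-½)R + ηA^(-½)T + η²P) - a²(β-α)(P - αQ)`. -/
noncomputable def invCoords : Coords H →L[ℂ] Coords H :=
  let π := fun i => PiLp.proj (𝕜 := ℂ) 2 (fun _ : Fin 4 => H) i
  let L := A.negPow (1 / 2)
  (PiLp.continuousLinearEquiv 2 ℂ (fun _ : Fin 4 => H)).symm.toContinuousLinearMap ∘L
    ContinuousLinearMap.pi ![
      -(((c.a ^ 2 : ℝ) : ℂ)⁻¹ • (L ∘L π 2 + (c.η : ℂ) • L ∘L π 3 + ((c.η ^ 2 : ℝ) : ℂ) • π 0))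
        - ((c.β - c.α : ℝ) : ℂ) • (π 0 - (c.α : ℂ) • π 1),
      π 0 - (c.α : ℂ) • π 1,
      L ∘L π 0,
      -((c.η : ℂ) • L ∘L π 0) - A.inv ∘L π 3]

theorem invCoords_zero (x : Coords H) : ((c.a ^ 2 : ℝ) : ℂ) • invCoords A c x 0
    = -(A.negPow (1 / 2) (x 2) + (c.η : ℂ) • A.negPow (1 / 2) (x 3) + ((c.η ^ 2 : ℝ) : ℂ) • x 0)
      - ((c.a ^ 2 * (c.β - c.α) : ℝ) : ℂ) • (x 0 - (c.α : ℂ) • x 1) := by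
  have ha : ((c.a ^ 2 : ℝ) : ℂ) ≠ 0 := by exact_mod_cast pow_ne_zero 2 c.a_ne_zero
  change ((c.a ^ 2 : ℝ) : ℂ) • (-(((c.a ^ 2 : ℝ) : ℂ)⁻¹ • (A.negPow (1 / 2) (x 2)
    + (c.η : ℂ) • A.negPow (1 / 2) (x 3) + ((c.η ^ 2 : ℝ) : ℂ) • x 0))
    - ((c.β - c.α : ℝ) : ℂ) • (x 0 - (c.α : ℂ) • x 1)) = _
  rw [smul_sub _ (-_), smul_neg, smul_inv_smul₀ ha, smul_smul, Complex.ofReal_mul]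

theorem invCoords_one (x : Coords H) : invCoords A c x 1 = x 0 - (c.α : ℂ) • x 1 := rfl

theorem invCoords_two (x : Coords H) : invCoords A c x 2 = A.negPow (1 / 2) (x 0) := rfl

theorem invCoords_three (x : Coords H) :
    invCoords A c x 3 = -((c.η : ℂ) • A.negPow (1 / 2) (x 0)) - A.inv (x 3) := rfl

/-- The bounded inverse of `opB A c 1`. -/
noncomputable def opBInv : PhaseSpace A c →L[ℂ] PhaseSpace A c :=
  (coords (A := A) (c := c)).symm.toContinuousLinearMap ∘L invCoords A c ∘L
    (coords (A := A) (c := c)).toContinuousLinearMap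

variable {A c}

theorem coordsₗ_opBInv (F : PhaseSpace A c) :
    coordsₗ (opBInv A c F) = invCoords A c (coordsₗ F) :=
  (coords (A := A) (c := c)).apply_symm_apply (invCoords A c (coordsₗ F))

theorem stress_one (U : PhaseSpace A c) : stress A c 1 U = ((c.a ^ 2 : ℝ) : ℂ) • (u U : H)
    + ((c.a ^ 2 * c.β : ℝ) : ℂ) • (v U : H) - (c.η : ℂ) • θ U := by
  have h : A.negPow (1 - 1) = 1 := by rw [sub_self, A.negPow_zero]
  change _ + _ - (c.η : ℂ) • A.negPow (1 - 1) (θ U) = _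
  rw [h]
  rfl

theorem flux_one (U : PhaseSpace A c) : flux A c 1 U = (c.η : ℂ) • (v U : H)
    + ((c.α * c.η : ℝ) : ℂ) • w U + θ U := by
  have h : A.negPow (1 - 1) = 1 := by rw [sub_self, A.negPow_zero]
  change (c.η : ℂ) • A.negPow (1 - 1) (v U : H)
    + ((c.α * c.η : ℝ) : ℂ) • A.negPow (1 - 1) (w U) + θ U = _
  rw [h]
  rfl

theorem mem_graph_opB_iff (φ : ℝ) (U F : PhaseSpace A c) : (U, F) ∈ (opB A c φ).graph ↔
    v U = u F ∧ w U = v F ∧ stress A c φ U = -A.inv ((c.α : ℂ) • w F + w U) ∧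
      flux A c φ U = -A.inv (θ F) := by
  have hα : (c.α : ℂ) ≠ 0 := by exact_mod_cast c.α_pos.ne'
  rw [LinearPMap.mem_graph_iff]
  constructor
  · rintro ⟨V, hV, hF⟩
    obtain rfl : (V : PhaseSpace A c) = U := hV
    obtain rfl : opB A c φ V = F := hF
    refine ⟨rfl, rfl, ?_, ?_⟩
    · change _ = -A.inv ((c.α : ℂ) • -((c.α : ℂ)⁻¹ •
        (A.toLinearPMap ⟨stress A c φ V.1, V.2.1.2⟩ + w V.1)) + w V.1)
      rw [smul_neg, smul_inv_smul₀ hα, neg_add_rev, neg_add_cancel_comm, map_neg, A.inv_apply,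
        neg_neg]
    · change _ = -A.inv (-A.toLinearPMap ⟨flux A c φ V.1, V.2.2⟩)
      rw [map_neg, neg_neg, A.inv_apply]
  · rintro ⟨h1, h2, h3, h4⟩
    rw [← map_neg] at h3 h4
    obtain ⟨m3, e3⟩ := (A.exists_apply_eq_iff _ _).2 h3
    obtain ⟨m4, e4⟩ := (A.exists_apply_eq_iff _ _).2 h4
    have m2 : w U ∈ A.halfDomain := by rw [h2]; exact (v F).2
    refine ⟨⟨U, ⟨⟨m2, m3⟩, m4⟩⟩, rfl, PhaseSpace.ext h1 (Subtype.ext h2) ?_ ?_⟩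
    · change -((c.α : ℂ)⁻¹ • (A.toLinearPMap ⟨stress A c φ U, m3⟩ + w U)) = w F
      rw [e3, ← smul_neg, inv_smul_eq_iff₀ hα]
      abel
    · change -A.toLinearPMap ⟨flux A c φ U, m4⟩ = θ F
      rw [e4, neg_neg]

/-- The first coordinate of the inverse, after an application of the injective `A^(-½)`. -/
theorem coordsₗ_zero_eq_iff (U F : PhaseSpace A c) :
    coordsₗ U 0 = invCoords A c (coordsₗ F) 0 ↔
      ((c.a ^ 2 : ℝ) : ℂ) • ((u U : H) + (c.α : ℂ) • (v U : H))
        = -(A.inv (coordsₗ F 2) + (c.η : ℂ) • A.inv (coordsₗ F 3)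
            + ((c.η ^ 2 : ℝ) : ℂ) • A.negPow (1 / 2) (coordsₗ F 0))
          - ((c.a ^ 2 * (c.β - c.α) : ℝ) : ℂ) •
            (A.negPow (1 / 2) (coordsₗ F 0 - (c.α : ℂ) • coordsₗ F 1)) := by
  have ha : ((c.a ^ 2 : ℝ) : ℂ) ≠ 0 := by exact_mod_cast pow_ne_zero 2 c.a_ne_zero
  have hU : A.negPow (1 / 2) (coordsₗ U 0) = (u U : H) + (c.α : ℂ) • (v U : H) := by
    rw [coordsₗ_zero, map_add, map_smul, A.negPow_half_half, A.negPow_half_half]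
  rw [← smul_right_inj ha, invCoords_zero, ← A.negPow_half_injective.eq_iff, map_smul, hU]
  simp only [map_sub, map_neg, map_add, map_smul, A.negPow_half_apply_apply]

theorem mem_graph_opB_one_iff (U F : PhaseSpace A c) :
    (U, F) ∈ (opB A c 1).graph ↔ U = opBInv A c F := by
  have hα : (c.α : ℂ) ≠ 0 := by exact_mod_cast c.α_pos.ne'
  have hU : U = opBInv A c F ↔ coordsₗ U 0 = invCoords A c (coordsₗ F) 0 ∧
      coordsₗ U 1 = invCoords A c (coordsₗ F) 1 ∧ coordsₗ U 2 = invCoords A c (coordsₗ F) 2 ∧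
        coordsₗ U 3 = invCoords A c (coordsₗ F) 3 := by
    rw [← coordsₗ_opBInv]
    constructor
    · rintro rfl
      exact ⟨rfl, rfl, rfl, rfl⟩
    · rintro ⟨h0, h1, h2, h3⟩
      refine coordsₗ.injective (PiLp.ext fun i => ?_)
      fin_cases i
      exacts [h0, h1, h2, h3]
  have e1 : coordsₗ U 1 = invCoords A c (coordsₗ F) 1 ↔ v U = u F := by
    rw [invCoords_one, coordsₗ_one, coordsₗ_zero, coordsₗ_one, add_sub_cancel_right]
    exact A.halfEquiv.injective.eq_iff
  have e0F : A.negPow (1 / 2) (coordsₗ F 0) = (u F : H) + (c.α : ℂ) • (v F : H) := by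
    rw [coordsₗ_zero, map_add, map_smul, A.negPow_half_half, A.negPow_half_half]
  have e1F : A.negPow (1 / 2) (coordsₗ F 0 - (c.α : ℂ) • coordsₗ F 1) = u F := by
    rw [coordsₗ_zero, coordsₗ_one, add_sub_cancel_right, A.negPow_half_half]
  rw [mem_graph_opB_iff, hU, e1, coordsₗ_zero_eq_iff, e1F, e0F, invCoords_two, invCoords_three, e0F, coordsₗ_two,
    coordsₗ_two, coordsₗ_three, coordsₗ_three, stress_one, flux_one, map_add, map_add, map_smul]
  push_cast
  constructor
  · rintro ⟨h1, h2, h3, h4⟩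
    have h1' : (v U : H) = u F := by rw [h1]
    rw [h2] at h3 h4 ⊢
    rw [h1'] at h3 h4 ⊢
    refine ⟨?_, h1, rfl, ?_⟩
    · linear_combination (norm := module) h3 + (c.η : ℂ) • h4
    · linear_combination (norm := module) h4
  · rintro ⟨h0, h1, h2, h3⟩
    have h1' : (v U : H) = u F := by rw [h1]
    rw [h1'] at h0 h2 ⊢
    have h2' : w U = v F := smul_right_injective H hα (add_left_cancel h2)
    rw [h2']
    refine ⟨h1, rfl, ?_, ?_⟩
    · linear_combination (norm := module) h0 - (c.η : ℂ) • h3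
    · linear_combination (norm := module) h3

/-! ### The forms of the operator -/

/-- The variable `t` with `θ = A^(-½) t` for `U = opBInv F`, in terms of the coordinates of `F`. -/
theorem invCoords_three_eq (x : Coords H) : invCoords A c x 3
    = A.negPow (1 / 2) (-((c.η : ℂ) • x 0) - A.negPow (1 / 2) (x 3)) := by
  rw [invCoords_three, map_sub, map_neg, map_smul, A.negPow_half_apply_apply]

/-- The definition of the first coordinate `p` of the inverse, solved for `A^(-½)R`: in the form of the
operator this trades the unbounded term in `R` for the energy variables. -/
theorem negPow_half_two_eq (x : Coords H) : A.negPow (1 / 2) (x 2)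
    = -((c.a ^ 2 : ℝ) : ℂ) • invCoords A c x 0
      - ((c.a ^ 2 * (c.β - c.α) : ℝ) : ℂ) • invCoords A c x 1
      + (c.η : ℂ) • (-((c.η : ℂ) • x 0) - A.negPow (1 / 2) (x 3)) := by
  rw [neg_smul, invCoords_zero, invCoords_one]
  push_cast
  module

theorem re_inner_opBInv_nonpos (F : PhaseSpace A c) : (inner ℂ (opBInv A c F) F).re ≤ 0 := by
  set x := coordsₗ F with hx
  set t := -((c.η : ℂ) • x 0) - A.negPow (1 / 2) (x 3) with ht
  have hτ : A.negPow (1 / 2) (x 3) = -(c.η : ℂ) • x 0 - t := by rw [ht]; module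
  have hQ : (c.α : ℂ) • x 1 = x 0 - invCoords A c x 1 := by rw [invCoords_one]; module
  have hg : 0 ≤ c.a ^ 2 * (c.β - c.α) :=
    mul_nonneg (sq_nonneg _) (sub_nonneg.2 c.α_lt_β.le)
  convert re_energyForm_nonpos c.a hg c.η (invCoords A c x 0) (invCoords A c x 1) (x 0) t using 2
  rw [inner_eq_coords, coordsₗ_opBInv, ← hx, ← hQ, ← hτ, inner_smul_right, ht,
    ← negPow_half_two_eq, invCoords_two, invCoords_three_eq, A.inner_negPow_half,
    A.inner_negPow_half]
  push_cast
  ring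

end MGTFourier

/-! ### Generation of the semigroup -/

/-- For `φ = 1` and a nonzero coupling constant, `𝔹` is the infinitesimal generator of a
`C₀`-semigroup of contractions `S(t) = e^{t𝔹}` on the phase space, and `S` is analytic. -/
theorem theorem13 {H : Type*} [NormedAddCommGroup H] [InnerProductSpace ℂ H] [CompleteSpace H]
    (A : StrictlyPositiveOperator H) (c : MGTFourierCoeffs) (hη : c.η ≠ 0) :
    ∃ S : ℝ → MGTFourier.PhaseSpace A c →L[ℂ] MGTFourier.PhaseSpace A c,
      IsC0Semigroup S ∧ IsGenerator (MGTFourier.opB A c 1) S ∧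
      (∀ t : ℝ, 0 ≤ t → ‖S t‖ ≤ 1) ∧ IsAnalyticSemigroup S := by
  open MGTFourier in
  obtain ⟨κ, hκ⟩ : ∃ κ, κ = c.η / (1 + c.η ^ 2) := ⟨_, rfl⟩
  have hκ2 : |κ| ≤ 1 / 2 := by
    have : 0 < 1 + c.η ^ 2 := by positivity
    rw [hκ, abs_div, abs_of_pos this, div_le_iff₀ this, ← sq_abs]
    nlinarith [sq_nonneg (|c.η| - 1)]
  obtain ⟨γ, hγ⟩ : ∃ γ : ℝ, κ ^ 2 + γ ^ 2 = 1 := by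
    refine ⟨√(1 - κ ^ 2), ?_⟩
    rw [Real.sq_sqrt, add_sub_cancel]
    rw [← sq_abs]
    nlinarith [abs_nonneg κ]
  obtain ⟨K, hK, hKU⟩ := exists_norm_coordsₗ_le (A := A) (c := c)
  obtain ⟨k, C, hk, hC, hkC⟩ := exists_sectorial_bound (H := H) (a := c.a) (b := c.α⁻¹)
    (g := c.a ^ 2 * (c.β - c.α)) hη hκ
  refine exists_analytic_contraction_semigroup (opB A c 1) mem_graph_opB_one_iff
    re_inner_opBInv_nonpos (shearCoords H κ γ ∘L (coords (A := A) (c := c)).toContinuousLinearMap)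
    (m := (2 * K)⁻¹) (by positivity) (fun U => ?_) hk hC fun F => ?_
  · have h1 := norm_le_two_mul_norm_shearCoords hγ hκ2 (coordsₗ U)
    have h2 := (hKU U).2
    rw [inv_mul_le_iff₀ (by positivity)]
    change ‖U‖ ≤ 2 * K * ‖shearCoords H κ γ (coordsₗ U)‖
    nlinarith
  · change |(inner ℂ (shearCoords H κ γ (coordsₗ (opBInv A c F)))
      (shearCoords H κ γ (coordsₗ F))).im| ≤ C * (k * ‖shearCoords H κ γ (coordsₗ (opBInv A c F))‖
      ^ 2 - (inner ℂ (shearCoords H κ γ (coordsₗ (opBInv A c F)))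
      (shearCoords H κ γ (coordsₗ F))).re)
    rw [coordsₗ_opBInv]
    set x := coordsₗ F
    set t := -((c.η : ℂ) • x 0) - A.negPow (1 / 2) (x 3) with ht
    have hα : (c.α : ℂ) ≠ 0 := by exact_mod_cast c.α_pos.ne'
    have hQ : inner ℂ (invCoords A c x 1) (x 1)
        = ((c.α⁻¹ : ℝ) : ℂ) * inner ℂ (invCoords A c x 1) (x 0 - invCoords A c x 1) := by
      rw [← inner_smul_right]
      congr 1
      rw [invCoords_one, sub_sub_cancel, Complex.ofReal_inv, inv_smul_smul₀ hα]
    have h := hkC (invCoords A c x 0) (invCoords A c x 1) (x 0) t _ _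
      (inner ℂ (shearCoords H κ γ (invCoords A c x)) (shearCoords H κ γ x)) (negPow_half_two_eq x)
      (show A.negPow (1 / 2) (x 3) = -(c.η : ℂ) • x 0 - t by rw [ht]; module) (by
        rw [inner_shearCoords hγ, hQ, invCoords_two, invCoords_three_eq, ← ht]
        simp only [A.inner_negPow_half]
        ring)
    refine h.trans (mul_le_mul_of_nonneg_left (sub_le_sub_right (mul_le_mul_of_nonneg_left ?_ hk) _)
      hC.le)
    rw [norm_sq_shearCoords]
    have : 0 ≤ ‖invCoords A c x 2 + (κ : ℂ) • invCoords A c x 3‖ ^ 2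
      + γ ^ 2 * ‖invCoords A c x 3‖ ^ 2 := by positivity
    linarith
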